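/- Let $K$ be an algebraically closed field of characteristic $0$ and let $X\subset\mathbb{P}^n=\mathbb{P}^n_K$ be an integral closed subvariety of dimension $m$ which is non-degenerate, i.e. not contained in any hyperplane. For a linear subspace $V\subseteq\mathbb{P}^n$ let the $X$-rank $R_X(V)$ be the minimal cardinality of a finite set $S\subset X$ of points such that $V\subseteq\langle S\rangle$, where $\langle\cdot\rangle$ denotes the linear span in $\mathbb{P}^n$. Then for every linear subspace $V\subseteq\mathbb{P}^n$ the $X$-rank $R_X(V)$ is finite and $$R_X(V)\le n+2-m+\dim\langle (X\cap V)_{\mathrm{red}}\rangle,$$ where $(X\cap V)_{\mathrm{red}}$ is the set of points lying on both $X$ and $V$, and the span of the empty set is the empty linear subspace, of dimension $-1$. -/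

import Mathlib

open scoped LinearAlgebra.Projectivization

namespace XRank

section

variable {K : Type*} [Field K] {n : ℕ}

/-- The common zeros in `ℙⁿ` of a set of polynomials. For homogeneous polynomials (the only ones
this is used for) the choice of the representative `p.rep` does not matter. -/
def zeroLocus (S : Set (MvPolynomial (Fin (n + 1)) K)) : Set (ℙ K (Fin (n + 1) → K)) :=
  {p | ∀ f ∈ S, MvPolynomial.eval p.rep f = 0}

/-- A subset of `ℙⁿ` is algebraic if it is the zero locus of a set of homogeneous polynomials. -/
def IsAlgebraicSet (X : Set (ℙ K (Fin (n + 1) → K))) : Prop :=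
  ∃ S : Set (MvPolynomial (Fin (n + 1)) K), (∀ f ∈ S, ∃ d : ℕ, f.IsHomogeneous d) ∧
    X = zeroLocus S

theorem isAlgebraicSet_empty : IsAlgebraicSet (∅ : Set (ℙ K (Fin (n + 1) → K))) := by
  refine ⟨{1}, ?_, ?_⟩
  · rintro f rfl
    exact ⟨0, MvPolynomial.isHomogeneous_one _ _⟩
  · ext p
    simp [zeroLocus]

theorem isAlgebraicSet_sInter (A : Set (Set (ℙ K (Fin (n + 1) → K))))
    (hA : ∀ X ∈ A, IsAlgebraicSet X) : IsAlgebraicSet (⋂₀ A) := by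
  choose! S hS hX using hA
  refine ⟨⋃ X ∈ A, S X, ?_, ?_⟩
  · intro f hf
    obtain ⟨X, hXA, hf⟩ := Set.mem_iUnion₂.1 hf
    exact hS X hXA f hf
  · ext p
    constructor
    · intro hp f hf
      obtain ⟨X, hXA, hf⟩ := Set.mem_iUnion₂.1 hf
      have h := hp X hXA
      rw [hX X hXA] at h
      exact h f hf
    · intro hp X hXA
      rw [hX X hXA]
      exact fun f hf => hp f (Set.mem_iUnion₂.2 ⟨X, hXA, hf⟩)

theorem isAlgebraicSet_union (X Y : Set (ℙ K (Fin (n + 1) → K)))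
    (hX : IsAlgebraicSet X) (hY : IsAlgebraicSet Y) : IsAlgebraicSet (X ∪ Y) := by
  obtain ⟨S, hS, rfl⟩ := hX
  obtain ⟨T, hT, rfl⟩ := hY
  refine ⟨{h | ∃ f ∈ S, ∃ g ∈ T, h = f * g}, ?_, ?_⟩
  · rintro h ⟨f, hf, g, hg, rfl⟩
    obtain ⟨d, hd⟩ := hS f hf
    obtain ⟨e, he⟩ := hT g hg
    exact ⟨d + e, hd.mul he⟩
  · ext p
    constructor
    · rintro (hp | hp) h ⟨f, hf, g, hg, rfl⟩
      · simp [hp f hf]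
      · simp [hp g hg]
    · intro hp
      by_contra hcon
      simp only [Set.mem_union, zeroLocus, Set.mem_ofPred_eq, not_or, not_forall] at hcon
      obtain ⟨⟨f, hf, hfp⟩, ⟨g, hg, hgp⟩⟩ := hcon
      have h := hp (f * g) ⟨f, hf, g, hg, rfl⟩
      rw [map_mul] at h
      exact (mul_ne_zero hfp hgp) h

variable (K n) in
/-- The Zariski topology on `ℙⁿ(K)`: the closed sets are the algebraic sets. -/
abbrev zariskiTopology : TopologicalSpace (ℙ K (Fin (n + 1) → K)) :=
  TopologicalSpace.ofClosed {X | IsAlgebraicSet X} isAlgebraicSet_empty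
    (fun A hA => isAlgebraicSet_sInter A hA)
    (fun X hX Y hY => isAlgebraicSet_union X Y hX hY)

/-- Integral (reduced and irreducible) subvarieties of `ℙⁿ`, over an algebraically closed field,
given by their sets of points: the irreducible (in particular non-empty) Zariski closed sets. -/
def IsIntegralSubvariety (X : Set (ℙ K (Fin (n + 1) → K))) : Prop :=
  @IsClosed _ (zariskiTopology K n) X ∧ @IsIrreducible _ (zariskiTopology K n) X

/-- The dimension of a subset of `ℙⁿ`: the Krull dimension of the subspace topology induced by the
Zariski topology. -/
noncomputable def dimension (X : Set (ℙ K (Fin (n + 1) → K))) : WithBot ℕ∞ :=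
  letI := zariskiTopology K n
  topologicalKrullDim X

/-- `X` is non-degenerate if it spans `ℙⁿ`, i.e. lies in no proper linear subspace. -/
def IsNondegenerate (X : Set (ℙ K (Fin (n + 1) → K))) : Prop :=
  Projectivization.Subspace.span X = ⊤

/-- The projective dimension of a linear subspace of `ℙⁿ`; the empty subspace has dimension
`-1`. -/
noncomputable def linearDim (L : Projectivization.Subspace K (Fin (n + 1) → K)) : ℤ :=
  (Module.finrank K (Projectivization.Subspace.submodule L) : ℤ) - 1

/-- The `X`-rank of a linear subspace `V`: the minimal cardinality of a finite set `S ⊆ X` with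
`V ⊆ ⟨S⟩` (and `⊤` if there is no such set). -/
noncomputable def rank (X : Set (ℙ K (Fin (n + 1) → K)))
    (V : Projectivization.Subspace K (Fin (n + 1) → K)) : ℕ∞ :=
  ⨅ (S : Finset (ℙ K (Fin (n + 1) → K))) (_ : (S : Set (ℙ K (Fin (n + 1) → K))) ⊆ X)
    (_ : V ≤ Projectivization.Subspace.span (S : Set (ℙ K (Fin (n + 1) → K)))), (S.card : ℕ∞)

end

end XRank

/-! Work with cones in `K ^ (n + 1)`. Let `Z = X ∩ V` and let `U` be a complement of the span of `Z`
in `V`; then `U` misses `X`. Enlarge `U` to a maximal subspace missing `X`. The projection `h` from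
it is finite on `X`, and maximality makes it surjective onto `ℙʳ` (`exists_projection`), so `m ≤ r`
(`dimension_le_of_projection`). The heart is `exists_subset_cone_span`: points of `X` in a general
fibre of `h` span a space that contains the center and has vector dimension at most `n + 1 - r`.
Adding points that span `⟨Z⟩` gives the bound.

Why a fibre spans the center: let `x` be the generic point of the cone, with function field `F`, and
let `E = K(h(x))`. The conjugates of `x` over `E` form the generic fibre, and they span as soon as
`1` and the linear forms complementary to `h`, evaluated at `x`, are independent over `E`. Over `K`
this is nondegeneracy. The base field is then enlarged by one coordinate at a time
(`linearIndependent_adjoin_simple`, `linearIndependent_of_mulStable`), an algebraic version of the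
fact that general hyperplane sections stay nondegenerate. Each step needs the base field to be
algebraically closed in `F`, which a general member of a pencil preserves
(`exists_algebraicallyClosed_adjoin`, a Bertini theorem). Finally the conjugates are specialized to
`K`-points with a determinant kept nonzero (`exists_conjugate_specializations`). -/

namespace XRank

/-! ### Integrality over affine space and at infinity -/

section FunctionFields

open MvPolynomial

open scoped Pointwise IntermediateField.algebraAdjoinAdjoin

/-- Fractions of polynomials in `u` whose degree, numerator minus denominator, is not positive. -/
def degreeSubalgebra {k E σ : Type*} [Field k] [Field E] [Algebra k E] {u : σ → E}
    (_ : AlgebraicIndependent k u) : Subalgebra k E where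
  carrier := {x | ∃ P Q : MvPolynomial σ k, Q ≠ 0 ∧ P.totalDegree ≤ Q.totalDegree ∧
    x * aeval u Q = aeval u P}
  mul_mem' := by
    rintro x y ⟨P, Q, hQ, hd, hx⟩ ⟨P', Q', hQ', hd', hy⟩
    refine ⟨P * P', Q * Q', mul_ne_zero hQ hQ', ?_, ?_⟩
    · rw [totalDegree_mul_of_isDomain hQ hQ']
      exact (totalDegree_mul _ _).trans (add_le_add hd hd')
    · rw [map_mul, map_mul, ← hx, ← hy]
      ring
  add_mem' := by
    rintro x y ⟨P, Q, hQ, hd, hx⟩ ⟨P', Q', hQ', hd', hy⟩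
    refine ⟨P * Q' + P' * Q, Q * Q', mul_ne_zero hQ hQ', ?_, ?_⟩
    · rw [totalDegree_mul_of_isDomain hQ hQ']
      refine (totalDegree_add _ _).trans (max_le ?_ ?_)
      · exact (totalDegree_mul _ _).trans (add_le_add hd le_rfl)
      · rw [add_comm Q.totalDegree]
        exact (totalDegree_mul _ _).trans (add_le_add hd' le_rfl)
    · rw [map_add, map_mul, map_mul, map_mul, ← hx, ← hy]
      ring
  algebraMap_mem' c := ⟨C c, 1, one_ne_zero, by simp, by simp⟩

/-- Any fraction or its inverse has nonpositive degree, so this is a valuation ring of `E`, hence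
integrally closed. -/
theorem mem_degreeSubalgebra_of_isIntegral {k E σ : Type*} [Field k] [Field E] [Algebra k E]
    {u : σ → E} (hu : AlgebraicIndependent k u)
    (hE : IntermediateField.adjoin k (Set.range u) = ⊤) {x : E}
    (hx : IsIntegral (degreeSubalgebra hu) x) : x ∈ degreeSubalgebra hu := by
  have hval : ∀ y : E, y ∈ degreeSubalgebra hu ∨ y⁻¹ ∈ degreeSubalgebra hu := by
    intro y
    obtain ⟨P, Q, hPQ⟩ := (IntermediateField.mem_adjoin_range_iff k u y).1 (hE ▸ trivial)
    by_cases hQ : Q = 0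
    · have : y = 0 := by simp [hPQ, hQ]
      exact .inl (this ▸ zero_mem _)
    by_cases hP : P = 0
    · have : y = 0 := by simp [hPQ, hP]
      exact .inl (this ▸ zero_mem _)
    have hQ' : aeval u Q ≠ 0 := fun h => hQ (hu.eq_zero_of_aeval_eq_zero Q h)
    have hP' : aeval u P ≠ 0 := fun h => hP (hu.eq_zero_of_aeval_eq_zero P h)
    rcases le_total P.totalDegree Q.totalDegree with h | h
    · exact .inl ⟨P, Q, hQ, h, by rw [hPQ]; field_simp⟩
    · exact .inr ⟨Q, P, hP, h, by rw [hPQ]; field_simp⟩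
  let V : ValuationSubring E :=
    { (degreeSubalgebra hu).toSubring with mem_or_inv_mem' := hval }
  have hx' : IsIntegral V x := hx
  obtain ⟨y, hy⟩ := IsIntegrallyClosed.algebraMap_eq_of_integral hx'
  exact hy ▸ y.2

theorem mem_range_of_mem_degreeSubalgebra {k E σ : Type*} [Field k] [Field E] [Algebra k E]
    {u : σ → E} (hu : AlgebraicIndependent k u) {x : E} (hx : x ∈ degreeSubalgebra hu)
    (hx' : x ∈ Algebra.adjoin k (Set.range u)) : x ∈ Set.range (algebraMap k E) := by
  rw [Algebra.adjoin_range_eq_range_aeval] at hx'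
  obtain ⟨R, rfl⟩ := hx'
  obtain ⟨P, Q, hQ, hd, h⟩ := hx
  have h' : R * Q = P := hu (by simpa using h)
  by_cases hR : R = 0
  · exact ⟨0, by simp [hR]⟩
  rw [← h', totalDegree_mul_of_isDomain hR hQ] at hd
  have hR0 : R.totalDegree = 0 := by omega
  rw [totalDegree_eq_zero_iff_eq_C] at hR0
  exact ⟨R.coeff 0, by rw [hR0]; simp⟩

theorem mem_adjoin_of_isIntegral {k E σ : Type*} [Field k] [Field E] [Algebra k E]
    {u : σ → E} (hu : AlgebraicIndependent k u) {x : E}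
    (hx : x ∈ IntermediateField.adjoin k (Set.range u))
    (hx' : IsIntegral (Algebra.adjoin k (Set.range u)) x) :
    x ∈ Algebra.adjoin k (Set.range u) := by
  have : IsIntegrallyClosed (MvPolynomial σ k) := UniqueFactorizationMonoid.instIsIntegrallyClosed
  have : IsIntegrallyClosed (Algebra.adjoin k (Set.range u)) :=
    IsIntegrallyClosed.of_equiv hu.aevalEquiv.toRingEquiv
  have hx'' : IsIntegral (Algebra.adjoin k (Set.range u))
      (⟨x, hx⟩ : IntermediateField.adjoin k (Set.range u)) :=
    (isIntegral_algHom_iff (IsScalarTower.toAlgHom _ _ E) (FaithfulSMul.algebraMap_injective _ E)).1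
      hx'
  obtain ⟨y, hy⟩ := IsIntegrallyClosed.algebraMap_eq_of_integral hx''
  have h := y.2
  rw [show (y : E) = x from congrArg Subtype.val hy] at h
  exact h

/-- The coefficients of the minimal polynomial of an integral element are integral. -/
theorem isIntegral_coeff_minpoly {R E F : Type*} [CommRing R] [Field E] [Field F] [Algebra R E]
    [Algebra E F] [Algebra R F] [IsScalarTower R E F] {z : F} (hz : IsIntegral R z) (i : ℕ) :
    IsIntegral R ((minpoly E z).coeff i) :=
  Polynomial.isIntegral_coeff_of_dvd (minpoly R z) _ (minpoly.monic hz)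
    (minpoly.monic hz.tower_top) (minpoly.dvd_map_of_isScalarTower R E z) i

/-- The coefficients of the minimal polynomial over `E` are polynomials in `u` of nonpositive
degree, hence constants. Geometrically, a function on a finite cover of projective space that is
regular on the affine part and along infinity is constant. -/
theorem isAlgebraic_of_isIntegral_of_isIntegral {k E F σ : Type*} [Field k] [Field E] [Field F]
    [Algebra k E] [Algebra E F] [Algebra k F] [IsScalarTower k E F] {u : σ → E}
    (hu : AlgebraicIndependent k u) (hE : IntermediateField.adjoin k (Set.range u) = ⊤) {z : F}
    (h₁ : IsIntegral (Algebra.adjoin k (Set.range u)) z)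
    (h₂ : IsIntegral (degreeSubalgebra hu) z) : IsAlgebraic k z := by
  have hc : ∀ i, (minpoly E z).coeff i ∈ Set.range (algebraMap k E) := fun i =>
    mem_range_of_mem_degreeSubalgebra hu
      (mem_degreeSubalgebra_of_isIntegral hu hE (isIntegral_coeff_minpoly h₂ i))
      (mem_adjoin_of_isIntegral hu (hE ▸ trivial) (isIntegral_coeff_minpoly h₁ i))
  have hl : minpoly E z ∈ Polynomial.lifts (algebraMap k E) :=
    (Polynomial.lifts_iff_coeff_lifts _).2 hc
  obtain ⟨p, hp⟩ := hl
  have hzE : IsIntegral E z := h₁.tower_top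
  refine ⟨p, ?_, ?_⟩
  · rintro rfl
    exact minpoly.ne_zero hzE (by rw [← hp]; simp)
  · have := minpoly.aeval E z
    rw [← hp] at this
    simpa using this

/-- `w` maps `b` into the span of the products of elements of `m` and `b`. -/
def MulStable (k : Type*) {F : Type*} [Field k] [Field F] [Algebra k F] (m b : Set F) (w : F) :
    Prop :=
  ∀ x ∈ b, w * x ∈ Submodule.span k (m * b)

/-- Determinant trick: multiplication by `w / h` preserves the finitely generated module `R · b`.
The choice `h = 1` gives integrality on the affine part; `h` of degree one gives it at infinity. -/
theorem MulStable.isIntegral_div {k F R : Type*} [Field k] [Field F] [Algebra k F] [CommRing R]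
    [Algebra k R] [Algebra R F] [IsScalarTower k R F] {m b : Set F} (hb : b.Finite)
    (hb0 : ∃ x ∈ b, x ≠ 0) {w h : F} (hw : MulStable k m b w)
    (hm : ∀ y ∈ m, y / h ∈ Set.range (algebraMap R F)) : IsIntegral R (w / h) := by
  refine isIntegral_of_smul_mem_submodule (Submodule.span R b) ?_ (Submodule.fg_span hb) _ ?_
  · obtain ⟨x, hx, hx0⟩ := hb0
    exact fun h => hx0 ((Submodule.mem_bot R).1 (h ▸ Submodule.subset_span hx))
  have key : ∀ y ∈ Submodule.span k (m * b), y / h ∈ Submodule.span R b := by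
    intro y hy
    induction hy using Submodule.span_induction with
    | mem y hy =>
      obtain ⟨a, ha, x, hx, rfl⟩ := Set.mem_mul.1 hy
      obtain ⟨r, hr⟩ := hm a ha
      have : a * x / h = r • x := by rw [Algebra.smul_def, hr]; ring
      rw [this]
      exact Submodule.smul_mem _ _ (Submodule.subset_span hx)
    | zero => simp
    | add x y _ _ hx hy => rw [add_div]; exact add_mem hx hy
    | smul c x _ hx =>
      have : c • x / h = algebraMap k R c • (x / h) := by
        rw [algebraMap_smul, smul_div_assoc]
      rw [this]
      exact Submodule.smul_mem _ _ hx
  intro n hn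
  induction hn using Submodule.span_induction with
  | mem x hx =>
    rw [smul_eq_mul, div_mul_eq_mul_div]
    exact key _ (hw x hx)
  | zero => simp
  | add x y _ _ hx hy => rw [smul_add]; exact add_mem hx hy
  | smul c x _ hx => rw [smul_comm]; exact Submodule.smul_mem _ _ hx

theorem MulStable.sum {k F ι : Type*} [Field k] [Field F] [Algebra k F] {m b : Set F}
    (s : Finset ι) (c : ι → k) {w : ι → F} (hw : ∀ i, MulStable k m b (w i)) :
    MulStable k m b (∑ i ∈ s, c i • w i) := by
  intro x hx
  rw [Finset.sum_mul]
  refine sum_mem fun i _ => ?_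
  rw [smul_mul_assoc]
  exact Submodule.smul_mem _ _ (hw i x hx)

theorem MulStable.of_subset_span {k k' F : Type*} [Field k] [Field k'] [Field F] [Algebra k F]
    [Algebra k' F] [Algebra k k'] [IsScalarTower k k' F] {m m' b : Set F} {w : F}
    (hw : MulStable k m b w) (hm : m ⊆ Submodule.span k' m') : MulStable k' m' b w := by
  intro x hx
  have hle : Submodule.span k (m * b) ≤ (Submodule.span k' (m' * b)).restrictScalars k := by
    rw [Submodule.span_le]
    rintro _ ⟨a, ha, y, hy, rfl⟩
    have h := Submodule.mul_mem_mul (hm ha) (Submodule.subset_span (R := k') hy)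
    rwa [Submodule.span_mul_span] at h
  exact hle (hw x hx)

end FunctionFields

/-! ### Independence after adjoining one coordinate -/

section LinearIndependence

open MvPolynomial

open scoped Pointwise IntermediateField.algebraAdjoinAdjoin

/-- Suppose `∑ p j (u i₀) * w j = 0` and let `t ∈ k`. Then `z = (∑ p j (t) • w j) / (u i₀ - t)` is a
polynomial expression in `u i₀` and the `w j`, so it is integral over `k[u]`; as a quotient of
elements of degree one it is also integral at infinity. Hence `z` is a constant `c`, and
independence of `u i₀` and `w` over `k` forces `p j (t) = 0`. Since `k` is infinite, every `p j` is
zero. -/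
theorem linearIndependent_adjoin_simple {k E F σ ι : Type*} [Field k] [Field E] [Field F]
    [Infinite k] [Fintype ι] [Algebra k E] [Algebra E F] [Algebra k F] [IsScalarTower k E F]
    (hk : ∀ x : F, IsAlgebraic k x → x ∈ Set.range (algebraMap k F))
    {u : σ → E} (hu : AlgebraicIndependent k u)
    (hE : IntermediateField.adjoin k (Set.range u) = ⊤) {b : Set F} (hb : b.Finite)
    (hb0 : ∃ x ∈ b, x ≠ 0) {w : ι → F}
    (hw : ∀ j, MulStable k (insert 1 (Set.range (algebraMap E F ∘ u))) b (w j))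
    (i₀ : σ) {j₀ : ι} (hj₀ : w j₀ = 1)
    (hind : LinearIndependent k fun o : Option ι => o.elim (algebraMap E F (u i₀)) w) :
    LinearIndependent (IntermediateField.adjoin k {u i₀}) w := by
  classical
  have : IsScalarTower (Algebra.adjoin k {u i₀}) (IntermediateField.adjoin k {u i₀}) F :=
    .of_algebraMap_eq fun _ => rfl
  -- Clearing denominators, only relations with coefficients in `k[u i₀]` matter.
  rw [← LinearIndependent.iff_fractionRing (R := Algebra.adjoin k {u i₀}),
    Fintype.linearIndependent_iff]
  intro g hg
  have hg' : ∀ j, ∃ p : Polynomial k, Polynomial.aeval (u i₀) p = (g j : E) := fun j =>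
    (SetLike.ext_iff.1 (Algebra.adjoin_singleton_eq_range_aeval k (u i₀)) _).1 (g j).2
  choose p hp using hg'
  have hrel : ∑ j, algebraMap E F (Polynomial.aeval (u i₀) (p j)) * w j = 0 := by
    rw [← hg]
    refine Finset.sum_congr rfl fun j _ => ?_
    rw [hp, Algebra.smul_def]
    rfl
  suffices h : ∀ j, p j = 0 by
    intro j
    apply Subtype.ext
    rw [← hp j, h j]
    simp
  suffices h : ∀ (t : k) (j : ι), (p j).eval t = 0 by
    intro j
    exact Polynomial.funext fun t => by rw [h, Polynomial.eval_zero]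
  intro t
  set h : E := u i₀ - algebraMap k E t with hh
  have hX : (X i₀ - C t : MvPolynomial σ k).totalDegree ≥ 1 := by
    by_contra hlt
    have h1 : (X i₀ : MvPolynomial σ k).totalDegree ≤ max _ _ :=
      (congrArg totalDegree (sub_add_cancel (X i₀ : MvPolynomial σ k) (C t))).ge.trans
        (totalDegree_add _ _)
    rw [totalDegree_X, totalDegree_C] at h1
    omega
  have hX0 : (X i₀ - C t : MvPolynomial σ k) ≠ 0 := by
    intro h0
    rw [h0] at hX
    simp at hX
  have hhX : aeval u (X i₀ - C t : MvPolynomial σ k) = h := by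
    rw [map_sub, aeval_X, aeval_C]
  have hh0 : h ≠ 0 := by
    rw [← hhX]
    exact fun h0 => hX0 (hu.eq_zero_of_aeval_eq_zero _ h0)
  have hhF : algebraMap E F h ≠ 0 := by simpa using hh0
  have hO : IsIntegral (degreeSubalgebra hu)
      ((∑ j, (p j).eval t • w j) / algebraMap E F h) := by
    refine (MulStable.sum Finset.univ (fun j => (p j).eval t) hw).isIntegral_div hb hb0 ?_
    rintro y (rfl | ⟨i, rfl⟩)
    · refine ⟨⟨1 / h, 1, X i₀ - C t, hX0, by simp, ?_⟩, ?_⟩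
      · rw [hhX]
        simp [hh0]
      · simp [Subalgebra.algebraMap_def]
    · refine ⟨⟨u i / h, X i, X i₀ - C t, hX0, by simpa using hX, ?_⟩, ?_⟩
      · rw [hhX]
        simp [hh0]
      · simp [Subalgebra.algebraMap_def]
  have hA1 : ∀ j, IsIntegral (Algebra.adjoin k (Set.range u)) (w j) := by
    intro j
    rw [← div_one (w j)]
    refine (hw j).isIntegral_div hb hb0 ?_
    rintro y (rfl | ⟨i, rfl⟩)
    · exact ⟨1, by simp⟩
    · exact ⟨⟨u i, Algebra.subset_adjoin (Set.mem_range_self i)⟩, by simp [Subalgebra.algebraMap_def]⟩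
  have hq : ∀ j, ∃ q : Polynomial k,
      p j - Polynomial.C ((p j).eval t) = (Polynomial.X - Polynomial.C t) * q :=
    fun j => Polynomial.X_sub_C_dvd_sub_C_eval
  choose q hq using hq
  have hzA : (∑ j, (p j).eval t • w j) / algebraMap E F h =
      -∑ j, algebraMap E F (Polynomial.aeval (u i₀) (q j)) * w j := by
    rw [div_eq_iff hhF, neg_mul, Finset.sum_mul, ← sub_eq_zero, sub_neg_eq_add,
      ← Finset.sum_add_distrib, ← hrel]
    refine Finset.sum_congr rfl fun j _ => ?_
    have := congrArg (fun f => algebraMap E F (Polynomial.aeval (u i₀) f)) (hq j)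
    simp only [map_sub, map_mul, Polynomial.aeval_C, Polynomial.aeval_X] at this
    rw [hh, Algebra.smul_def, IsScalarTower.algebraMap_apply k E F, map_sub]
    linear_combination -(w j) * this
  have hA : IsIntegral (Algebra.adjoin k (Set.range u))
      ((∑ j, (p j).eval t • w j) / algebraMap E F h) := by
    rw [hzA]
    refine (IsIntegral.sum _ fun j _ => IsIntegral.mul ?_ (hA1 j)).neg
    have hmem : Polynomial.aeval (u i₀) (q j) ∈ Algebra.adjoin k (Set.range u) :=
      Algebra.adjoin_mono (Set.singleton_subset_iff.2 (Set.mem_range_self i₀))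
        (Polynomial.aeval_mem_adjoin_singleton k (u i₀))
    exact isIntegral_algebraMap (R := Algebra.adjoin k (Set.range u)) (A := F) (x := ⟨_, hmem⟩)
  obtain ⟨c, hc⟩ := hk _ (isAlgebraic_of_isIntegral_of_isIntegral hu hE hA hO)
  rw [eq_div_iff hhF] at hc
  rw [Fintype.linearIndependent_iff] at hind
  -- The relation `∑ p j (t) • w j = c (u i₀ - t)`, with the constant `c * t` absorbed by `w j₀ =
  -- 1`.
  have hz := hind (fun o => o.elim (-c) fun j => (p j).eval t + if j = j₀ then c * t else 0) (by
    rw [Fintype.sum_option]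
    simp only [Option.elim_none, Option.elim_some, add_smul, Finset.sum_add_distrib, ite_smul,
      zero_smul, Finset.sum_ite_eq', Finset.mem_univ, if_true, hj₀]
    rw [← hc, hh, map_sub, ← IsScalarTower.algebraMap_apply k E F, Algebra.smul_def,
      Algebra.smul_def, map_neg, map_mul]
    ring)
  have hc0 : c = 0 := by simpa using hz none
  intro j
  simpa [hc0] using hz (some j)

end LinearIndependence

/-! ### Purely transcendental extensions -/

section PurelyTranscendental

open MvPolynomial

/-- A generating family no larger than the transcendence degree is a transcendence basis. -/
theorem algebraicIndependent_of_adjoin_eq_top {k E σ : Type*} [Field k] [Field E] [Algebra k E]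
    [Finite σ] {u v : σ → E} (hu : AlgebraicIndependent k u)
    (hv : IntermediateField.adjoin k (Set.range v) = ⊤) : AlgebraicIndependent k v := by
  have : Algebra.IsAlgebraic (Algebra.adjoin k (Set.range v)) E := by
    rw [← IntermediateField.isAlgebraic_adjoin_iff_top]
    exact ⟨fun x => isAlgebraic_algebraMap
      (⟨x, hv ▸ trivial⟩ : IntermediateField.adjoin k (Set.range v))⟩
  exact (Algebra.IsAlgebraic.isTranscendenceBasis_of_lift_le_trdeg_of_finite k v hu.lift_cardinalMk_le_trdeg).1

theorem adjoin_tail_eq_top {k E : Type*} [Field k] [Field E] [Algebra k E] {r : ℕ}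
    {u : Fin (r + 1) → E} (hE : IntermediateField.adjoin k (Set.range u) = ⊤) :
    IntermediateField.adjoin (IntermediateField.adjoin k {u 0}) (Set.range (Fin.tail u)) = ⊤ := by
  rw [← IntermediateField.restrictScalars_eq_top_iff (K := k),
    IntermediateField.adjoin_adjoin_left, ← hE, Set.singleton_union, ← Fin.range_cons,
    Fin.cons_self_tail]

theorem algebraicIndependent_tail {k E : Type*} [Field k] [Field E] [Algebra k E] {r : ℕ}
    {u : Fin (r + 1) → E} (hu : AlgebraicIndependent k u) :
    AlgebraicIndependent (IntermediateField.adjoin k {u 0}) (Fin.tail u) := by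
  rw [IntermediateField.algebraicIndependent_adjoin_iff]
  have h := hu.adjoin_of_disjoint (s := {0}) (t := Set.range Fin.succ)
    (by rw [Set.disjoint_singleton_left]; rintro ⟨i, hi⟩; exact Fin.succ_ne_zero i hi)
  rw [Set.image_singleton] at h
  exact h.comp (fun i : Fin r => (⟨i.succ, i, rfl⟩ : Set.range (Fin.succ (n := r))))
    fun i j hij => Fin.succ_injective _ (congrArg Subtype.val hij)

theorem mem_range_of_isAlgebraic {k E σ : Type*} [Field k] [Field E] [Algebra k E]
    {u : σ → E} (hu : AlgebraicIndependent k u)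
    (hE : IntermediateField.adjoin k (Set.range u) = ⊤) {x : E} (hx : IsAlgebraic k x) :
    x ∈ Set.range (algebraMap k E) :=
  mem_range_of_mem_degreeSubalgebra hu
    (mem_degreeSubalgebra_of_isIntegral hu hE hx.isIntegral.tower_top)
    (mem_adjoin_of_isIntegral hu (hE ▸ trivial) hx.isIntegral.tower_top)

attribute [local instance] MvPolynomial.algebraMvPolynomial in
/-- If `k` is algebraically closed in `L`, then so is `k(v)` in `L(v)`. -/
theorem mem_adjoin_of_isAlgebraic {k L F σ : Type*} [Field k] [Field L] [Field F] [Algebra k L]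
    [Algebra L F] [Algebra k F] [IsScalarTower k L F]
    (hk : ∀ x : L, IsAlgebraic k x → x ∈ Set.range (algebraMap k L))
    {v : σ → F} (hv : AlgebraicIndependent L v) {x : F}
    (hx : x ∈ IntermediateField.adjoin L (Set.range v))
    (hx' : IsAlgebraic (Algebra.adjoin k (Set.range v)) x) :
    x ∈ IntermediateField.adjoin k (Set.range v) := by
  have hvk : AlgebraicIndependent k v := hv.restrictScalars (algebraMap k L).injective
  -- The multiple `d • x` is integral over `k[v]`, hence lies in the integrally closed ring `L[v]`.
  -- As a polynomial over `L` integral over `k[v]`, it has coefficients integral over `k`, which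
  -- therefore lie in `k`.
  obtain ⟨d, hd, hint⟩ := hx'.exists_integral_multiple
  have hd0 : (d : F) ≠ 0 := fun h => hd (Subtype.ext h)
  have hle : Algebra.adjoin k (Set.range v) ≤ (Algebra.adjoin L (Set.range v)).restrictScalars k :=
    Algebra.adjoin_le Algebra.subset_adjoin
  have hdL : (d : F) ∈ Algebra.adjoin L (Set.range v) := hle d.2
  have hintL : IsIntegral (Algebra.adjoin L (Set.range v)) (d • x) := by
    have : RingHom.IsIntegralElem
      ((algebraMap (Algebra.adjoin L (Set.range v)) F).comp (Subalgebra.inclusion hle).toRingHom)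
      (d • x) := hint
    exact this.of_comp
  have hmem : d • x ∈ Algebra.adjoin L (Set.range v) := by
    refine mem_adjoin_of_isIntegral hv ?_ hintL
    rw [Algebra.smul_def]
    exact mul_mem (IntermediateField.algebra_adjoin_le_adjoin _ _ hdL) hx
  rw [Algebra.adjoin_range_eq_range_aeval] at hmem
  obtain ⟨P, hP⟩ := hmem
  have hPint : IsIntegral (MvPolynomial σ k) P := by
    have h1 : RingHom.IsIntegralElem ((aeval v : MvPolynomial σ k →ₐ[k] F) : MvPolynomial σ k →+* F) (d • x) := by
      refine RingHom.IsIntegralElem.of_comp (f := (hvk.aevalEquiv.symm : Algebra.adjoin k (Set.range v) →+* MvPolynomial σ k)) ?_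
      have : ((aeval v : MvPolynomial σ k →ₐ[k] F) : MvPolynomial σ k →+* F).comp
          (hvk.aevalEquiv.symm : Algebra.adjoin k (Set.range v) →+* MvPolynomial σ k) = algebraMap (Algebra.adjoin k (Set.range v)) F := by
        ext y
        simpa using (hvk.algebraMap_aevalEquiv (hvk.aevalEquiv.symm y)).symm
      rw [this]
      exact hint
    refine RingHom.IsIntegralElem.of_map (g := ((aeval v : MvPolynomial σ L →ₐ[L] F) : MvPolynomial σ L →+* F))
      hv ?_
    have h2 : ((aeval v : MvPolynomial σ L →ₐ[L] F) : MvPolynomial σ L →+* F).comp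
        (algebraMap (MvPolynomial σ k) (MvPolynomial σ L)) =
        ((aeval v : MvPolynomial σ k →ₐ[k] F) : MvPolynomial σ k →+* F) := by
      ext
      · simp [← IsScalarTower.algebraMap_apply]
      · simp
    rw [h2]
    change RingHom.IsIntegralElem _ ((aeval v : MvPolynomial σ L →ₐ[L] F).toRingHom P)
    rw [hP]
    exact h1
  rw [MvPolynomial.isIntegral_iff_isIntegral_coeff] at hPint
  have hPk : P ∈ Set.range (MvPolynomial.map (σ := σ) (algebraMap k L)) :=
    MvPolynomial.mem_range_map_iff_coeffs_subset.2 fun c hc => by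
      obtain ⟨n, _, rfl⟩ := MvPolynomial.mem_coeffs_iff.1 hc
      exact hk _ (hPint n).isAlgebraic
  obtain ⟨p, rfl⟩ := hPk
  have hxd : x = aeval v p / d := by
    rw [eq_div_iff hd0]
    have : d • x = aeval v p := by
      rw [← hP]
      simp [aeval_map_algebraMap]
    rw [← this, Algebra.smul_def, mul_comm]
    rfl
  rw [hxd]
  refine div_mem ?_ (IntermediateField.algebra_adjoin_le_adjoin _ _ d.2)
  refine IntermediateField.algebra_adjoin_le_adjoin _ _ ?_
  rw [Algebra.adjoin_range_eq_range_aeval]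
  exact ⟨p, rfl⟩

end PurelyTranscendental

/-! ### Bertini-type choice of coordinates -/

section GenericSections

open MvPolynomial

open scoped Pointwise

theorem adjoin_cons_add_smul_eq_top {k E : Type*} [Field k] [Field E] [Algebra k E] {r : ℕ}
    {u : Fin (r + 2) → E} (hE : IntermediateField.adjoin k (Set.range u) = ⊤) (c : k) :
    IntermediateField.adjoin k
      (Set.range (Fin.cons (u 0 + c • u 1) (Fin.tail u) : Fin (r + 2) → E)) = ⊤ := by
  set v : Fin (r + 2) → E := Fin.cons (u 0 + c • u 1) (Fin.tail u) with hv
  rw [eq_top_iff, ← hE, IntermediateField.adjoin_le_iff]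
  have hmem : ∀ i, v i ∈ IntermediateField.adjoin k (Set.range v) :=
    fun i => IntermediateField.subset_adjoin _ _ (Set.mem_range_self i)
  have hs : ∀ i : Fin (r + 1), u i.succ ∈ IntermediateField.adjoin k (Set.range v) :=
    fun i => hmem i.succ
  rintro _ ⟨i, rfl⟩
  refine Fin.cases ?_ hs i
  have : u 0 = v 0 - c • u (Fin.succ 0) := by simp [hv]
  rw [this]
  exact sub_mem (hmem 0) (IntermediateField.smul_mem _ (hs 0))

theorem adjoin_pencil_eq_top {k E : Type*} [Field k] [Field E] [Algebra k E] {r : ℕ}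
    {u : Fin (r + 2) → E} (hE : IntermediateField.adjoin k (Set.range u) = ⊤) {c c' : k}
    (hc : c ≠ c') : IntermediateField.adjoin k (Set.range (Fin.cons (u 0 + c • u 1)
      (Fin.cons (u 0 + c' • u 1) (Fin.tail (Fin.tail u))) : Fin (r + 2) → E)) = ⊤ := by
  set v : Fin (r + 2) → E := Fin.cons (u 0 + c • u 1)
      (Fin.cons (u 0 + c' • u 1) (Fin.tail (Fin.tail u))) with hv
  rw [eq_top_iff, ← hE, IntermediateField.adjoin_le_iff]
  have hmem : ∀ i, v i ∈ IntermediateField.adjoin k (Set.range v) :=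
    fun i => IntermediateField.subset_adjoin _ _ (Set.mem_range_self i)
  have h0 : u 0 + c • u 1 ∈ IntermediateField.adjoin k (Set.range v) := hmem 0
  have h1 : u 0 + c' • u 1 ∈ IntermediateField.adjoin k (Set.range v) := hmem (Fin.succ 0)
  have hu1 : u 1 ∈ IntermediateField.adjoin k (Set.range v) := by
    have : u 1 = (c - c')⁻¹ • ((u 0 + c • u 1) - (u 0 + c' • u 1)) := by
      rw [add_sub_add_left_eq_sub, ← sub_smul, smul_smul, inv_mul_cancel₀ (sub_ne_zero.2 hc),
        one_smul]
    rw [this]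
    exact IntermediateField.smul_mem _ (sub_mem h0 h1)
  rintro _ ⟨i, rfl⟩
  refine Fin.cases ?_ (fun i => Fin.cases hu1 (fun i => hmem i.succ.succ) i) i
  rw [← add_sub_cancel_right (u 0) (c • u 1)]
  exact sub_mem h0 (IntermediateField.smul_mem _ hu1)

/-- If `k` is algebraically closed in `F`, then so is `k(s)` for a general member `s` of a
pencil. -/
theorem exists_algebraicallyClosed_adjoin {k E F : Type*} [Field k] [Field E] [Field F]
    [CharZero k] [Algebra k E] [Algebra E F] [Algebra k F] [IsScalarTower k E F]
    [FiniteDimensional E F] (hk : ∀ x : F, IsAlgebraic k x → x ∈ Set.range (algebraMap k F))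
    {r : ℕ} {u : Fin (r + 2) → E} (hu : AlgebraicIndependent k u)
    (hE : IntermediateField.adjoin k (Set.range u) = ⊤) :
    ∃ c : k, ∀ x : F, IsAlgebraic (IntermediateField.adjoin k {u 0 + c • u 1}) x →
      x ∈ Set.range (algebraMap (IntermediateField.adjoin k {u 0 + c • u 1}) F) := by
  have : CharZero E := charZero_of_injective_algebraMap (algebraMap k E).injective
  have : Finite (IntermediateField E F) :=
    Field.finite_intermediateField_of_exists_primitive_element E F
      (Field.exists_primitive_element E F)
  -- Pigeonhole: `F / E` has finitely many intermediate fields. With `s = u 0 + c • u 1`, `s' = u 0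
  -- + c' • u 1` and `L` the algebraic closure of `k(s)` in `F`, an `x` algebraic over `k(s')` then
  -- lies in the compositum of `E` and `L`.
  obtain ⟨c, c', hcc, hM⟩ := Finite.exists_ne_map_eq_of_infinite fun c : k =>
    IntermediateField.adjoin E
      (algebraicClosure (IntermediateField.adjoin k {u 0 + c • u 1}) F : Set F)
  refine ⟨c', fun x hx => ?_⟩
  set v : Fin (r + 2) → E := Fin.cons (u 0 + c • u 1)
      (Fin.cons (u 0 + c' • u 1) (Fin.tail (Fin.tail u))) with hv
  set v' : Fin (r + 2) → E := Fin.cons (u 0 + c' • u 1)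
      (Fin.cons (u 0 + c • u 1) (Fin.tail (Fin.tail u))) with hv'
  have htop : IntermediateField.adjoin k (Set.range v) = ⊤ := adjoin_pencil_eq_top hE hcc
  have htop' : IntermediateField.adjoin k (Set.range v') = ⊤ := adjoin_pencil_eq_top hE hcc.symm
  have hind := algebraicIndependent_tail (algebraicIndependent_of_adjoin_eq_top hu htop)
  have hind' := algebraicIndependent_tail (algebraicIndependent_of_adjoin_eq_top hu htop')
  have hgen := adjoin_tail_eq_top htop
  have hgen' := adjoin_tail_eq_top htop'
  set k₁ := IntermediateField.adjoin k {v 0} with hk₁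
  set L := algebraicClosure k₁ F with hL
  set y : Fin (r + 1) → F := algebraMap E F ∘ Fin.tail v with hy
  have hyL : AlgebraicIndependent L y :=
    (hind.map' (f := IsScalarTower.toAlgHom k₁ E F) (algebraMap E F).injective).algebraicClosure
  have hEL : ∀ e : E, algebraMap E F e ∈ IntermediateField.adjoin L (Set.range y) := by
    intro e
    have he : e ∈ IntermediateField.adjoin k₁ (Set.range (Fin.tail v)) := hgen ▸ trivial
    induction he using IntermediateField.adjoin_induction with
    | mem x hx =>
      obtain ⟨i, rfl⟩ := hx
      exact IntermediateField.subset_adjoin _ _ ⟨i, rfl⟩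
    | algebraMap a =>
      rw [← IsScalarTower.algebraMap_apply k₁ E F, IsScalarTower.algebraMap_apply k₁ L F]
      exact IntermediateField.algebraMap_mem _ _
    | add a b _ _ ha hb => rw [map_add]; exact add_mem ha hb
    | inv a _ ha => rw [map_inv₀]; exact inv_mem ha
    | mul a b _ _ ha hb => rw [map_mul]; exact mul_mem ha hb
  have hxM : x ∈ IntermediateField.adjoin E (L : Set F) := by
    have h : x ∈ IntermediateField.adjoin E
      (algebraicClosure (IntermediateField.adjoin k {u 0 + c' • u 1}) F : Set F) :=
      IntermediateField.subset_adjoin _ _ (mem_algebraicClosure_iff.2 hx)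
    rw [← hM] at h
    exact h
  have hxL : x ∈ IntermediateField.adjoin L (Set.range y) := by
    clear hx
    induction hxM using IntermediateField.adjoin_induction with
    | mem x hx => exact IntermediateField.algebraMap_mem _ (⟨x, hx⟩ : L)
    | algebraMap a => exact hEL a
    | add a b _ _ ha hb => exact add_mem ha hb
    | inv a _ ha => exact inv_mem ha
    | mul a b _ _ ha hb => exact mul_mem ha hb
  have hxalg : IsAlgebraic (Algebra.adjoin k (Set.range y)) x := by
    rw [IntermediateField.isAlgebraic_adjoin_iff] at hx
    have hle : (Algebra.adjoin k {u 0 + c' • u 1}).map (IsScalarTower.toAlgHom k E F) ≤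
        Algebra.adjoin k (Set.range y) := by
      rw [AlgHom.map_adjoin, Set.image_singleton]
      exact Algebra.adjoin_mono (Set.singleton_subset_iff.2 ⟨0, rfl⟩)
    let f : Algebra.adjoin k {u 0 + c' • u 1} →+* Algebra.adjoin k (Set.range y) :=
      ((Subalgebra.inclusion hle).comp
        ((IsScalarTower.toAlgHom k E F).subalgebraMap _)).toRingHom
    algebraize [f]
    have : IsScalarTower (Algebra.adjoin k {u 0 + c' • u 1}) (Algebra.adjoin k (Set.range y)) F :=
      .of_algebraMap_eq fun _ => rfl
    refine hx.extendScalars fun a b hab => Subtype.ext ((algebraMap E F).injective ?_)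
    exact congrArg Subtype.val hab
  have : IsScalarTower k L F := .of_algebraMap_eq fun _ => rfl
  -- Here `y` consists of `s'` and the untouched coordinates, so `x` lies in `L(y)` and is algebraic
  -- over `k(y)`; as `k` is algebraically closed in `L`, `x` lies in `k(y) ⊆ E`. Finally `E` is
  -- purely transcendental over `k(s')`.
  have hxk : x ∈ IntermediateField.adjoin k (Set.range y) := by
    refine mem_adjoin_of_isAlgebraic (fun z hz => ?_) hyL hxL hxalg
    obtain ⟨a, ha⟩ := hk z (hz.algHom (IsScalarTower.toAlgHom k L F))
    exact ⟨a, Subtype.ext ha⟩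
  have hxE : x ∈ Set.range (algebraMap E F) := by
    have hle : IntermediateField.adjoin k (Set.range y) ≤
        (IsScalarTower.toAlgHom k E F).fieldRange := by
      rw [IntermediateField.adjoin_le_iff]
      rintro _ ⟨i, rfl⟩
      exact ⟨_, rfl⟩
    exact hle hxk
  obtain ⟨e, rfl⟩ := hxE
  rw [isAlgebraic_algebraMap_iff (algebraMap E F).injective] at hx
  obtain ⟨a, ha⟩ := mem_range_of_isAlgebraic hind' hgen' hx
  exact ⟨a, by rw [← ha]; rfl⟩

/-- The coordinates are moved into the base field one at a time, after replacing `u 0` by a general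
`u 0 + c • u 1` so that the new base is again algebraically closed in `F`. The remaining coordinates
are counted among the `w` when `linearIndependent_adjoin_simple` is applied, which reproduces the
hypothesis for the next step. -/
theorem linearIndependent_of_mulStable {F ι : Type*} [Field F] [Fintype ι] {b : Set F}
    (hb : b.Finite) (hb0 : ∃ x ∈ b, x ≠ 0) {w : ι → F} {j₀ : ι} (hj₀ : w j₀ = 1) (r : ℕ) :
    ∀ {k E : Type u} [Field k] [Field E] [CharZero k] [Algebra k E] [Algebra E F] [Algebra k F]
      [IsScalarTower k E F] [FiniteDimensional E F]
      (_ : ∀ x : F, IsAlgebraic k x → x ∈ Set.range (algebraMap k F))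
      {u : Fin (r + 1) → E} (_ : AlgebraicIndependent k u)
      (_ : IntermediateField.adjoin k (Set.range u) = ⊤)
      (_ : ∀ j, MulStable k (insert 1 (Set.range (algebraMap E F ∘ u))) b (w j))
      (_ : LinearIndependent k (Sum.elim (algebraMap E F ∘ u) w)), LinearIndependent E w := by
  induction r with
  | zero =>
    intro k E _ _ _ _ _ _ _ _ hk u hu hE hw hind
    have hinj : Function.Injective fun o : Option ι =>
        (o.elim (Sum.inl 0) Sum.inr : Fin (0 + 1) ⊕ ι) := by
      rintro (_ | i) (_ | j) h <;> simp_all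
    have hcomp : (Sum.elim (algebraMap E F ∘ u) w ∘ fun o : Option ι =>
        (o.elim (Sum.inl 0) Sum.inr : Fin (0 + 1) ⊕ ι)) =
        fun o : Option ι => o.elim (algebraMap E F (u 0)) w := by
      funext o
      cases o <;> rfl
    have h := linearIndependent_adjoin_simple hk hu hE hb hb0 hw 0 hj₀
      (hcomp ▸ hind.comp _ hinj)
    have htop : ∀ e : E, e ∈ IntermediateField.adjoin k {u 0} := by
      intro e
      have hr : Set.range u = {u 0} := by
        ext x
        simp [Fin.exists_fin_one, eq_comm]
      rw [← hr, hE]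
      trivial
    rw [Fintype.linearIndependent_iff] at h ⊢
    intro g hg j
    have h' := h (fun j => ⟨g j, htop (g j)⟩) (by
      rw [← hg]
      refine Finset.sum_congr rfl fun j _ => ?_
      rw [Algebra.smul_def, Algebra.smul_def]
      rfl) j
    exact congrArg Subtype.val h'
  | succ r ih =>
    intro k E _ _ _ _ _ _ _ _ hk u hu hE hw hind
    obtain ⟨c, hc⟩ := exists_algebraicallyClosed_adjoin (F := F) hk hu hE
    set u' : Fin (r + 2) → E := Fin.cons (u 0 + c • u 1) (Fin.tail u) with hu'
    have hE' : IntermediateField.adjoin k (Set.range u') = ⊤ := adjoin_cons_add_smul_eq_top hE c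
    have hAI : AlgebraicIndependent k u' := algebraicIndependent_of_adjoin_eq_top hu hE'
    set k' := IntermediateField.adjoin k {u' 0} with hk'
    have : CharZero k' := charZero_of_injective_algebraMap (algebraMap k k').injective
    have hu0 : u 0 = u' 0 - c • u' 1 := (add_sub_cancel_right (u 0) (c • u 1)).symm
    have hsm : ∀ e : E, algebraMap E F (c • e) = c • algebraMap E F e := fun e => by
      rw [Algebra.smul_def, Algebra.smul_def, map_mul, IsScalarTower.algebraMap_apply k E F]
    have hw' : ∀ j, MulStable k (insert 1 (Set.range (algebraMap E F ∘ u'))) b (w j) := by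
      refine fun j => (hw j).of_subset_span ?_
      have hm : ∀ i, algebraMap E F (u' i) ∈
          Submodule.span k (insert 1 (Set.range (algebraMap E F ∘ u'))) :=
        fun i => Submodule.subset_span (Set.mem_insert_of_mem _ (Set.mem_range_self i))
      rintro _ (rfl | ⟨i, rfl⟩)
      · exact Submodule.subset_span (Set.mem_insert _ _)
      · refine Fin.cases ?_ (fun i => hm i.succ) i
        rw [Function.comp_apply, hu0, map_sub, hsm]
        exact sub_mem (hm 0) (Submodule.smul_mem _ _ (hm 1))
    have hw'' : ∀ j, MulStable k' (insert 1 (Set.range (algebraMap E F ∘ Fin.tail u'))) b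
        (w j) := by
      refine fun j => (hw' j).of_subset_span ?_
      have h1 : (1 : F) ∈
          Submodule.span k' (insert 1 (Set.range (algebraMap E F ∘ Fin.tail u'))) :=
        Submodule.subset_span (Set.mem_insert _ _)
      rintro _ (rfl | ⟨i, rfl⟩)
      · exact h1
      · refine Fin.cases ?_ (fun i => ?_) i
        · have := Submodule.smul_mem _ (⟨u' 0, IntermediateField.mem_adjoin_simple_self k _⟩ : k') h1
          rw [Algebra.smul_def, mul_one] at this
          exact this
        · exact Submodule.subset_span (Set.mem_insert_of_mem _ (Set.mem_range_self i))
    have hlin := linearIndependent_adjoin_simple (ι := Fin (r + 1) ⊕ ι)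
      (w := Sum.elim (algebraMap E F ∘ Fin.tail u') w) (j₀ := Sum.inr j₀) hk hAI hE' hb hb0 (by
        rintro (i | j)
        · intro x hx
          exact Submodule.subset_span (Set.mul_mem_mul
            (Set.mem_insert_of_mem _ (Set.mem_range_self i.succ)) hx)
        · exact hw' j) 0 hj₀ (by
        rw [Fintype.linearIndependent_iff] at hind ⊢
        intro g hg
        -- Expanding `u' 0 = u 0 + c • u 1` adds `c * g none` to the coefficient of `u 1`.
        have key := hind (Sum.elim (Fin.cons (g none) fun i : Fin (r + 1) =>
          g (some (Sum.inl i)) + if i = 0 then c * g none else 0)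
          fun j => g (some (Sum.inr j))) (by
            rw [← hg, Fintype.sum_option, Fintype.sum_sum_type, Fintype.sum_sum_type,
              Fin.sum_univ_succ, ← add_assoc]
            simp only [Sum.elim_inl, Sum.elim_inr, Fin.cons_zero, Fin.cons_succ, add_smul,
              Finset.sum_add_distrib, ite_smul, zero_smul, Finset.sum_ite_eq', Finset.mem_univ,
              if_true, Option.elim_none, Option.elim_some, Function.comp_apply]
            have h0 : algebraMap E F (u' 0) = algebraMap E F (u 0) + c • algebraMap E F (u 1) := by
              rw [← hsm, ← map_add]
              rfl
            rw [h0, smul_add, smul_smul, mul_comm (g none) c]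
            change _ + (∑ i : Fin (r + 1), g (some (Sum.inl i)) • algebraMap E F (u i.succ) +
              (c * g none) • algebraMap E F (u 1)) + _ = _ + _ +
                ∑ i : Fin (r + 1), g (some (Sum.inl i)) • algebraMap E F (u i.succ) + _
            abel)
        have h0 : g none = 0 := by simpa using key (Sum.inl 0)
        rintro (_ | i | j)
        · exact h0
        · simpa [h0] using key (Sum.inl i.succ)
        · simpa using key (Sum.inr j))
    exact ih (k := k') hc (algebraicIndependent_tail hAI) (adjoin_tail_eq_top hE') hw'' hlin

end GenericSections

/-! ### Specialization of conjugate points -/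

section Specialization

open MvPolynomial

theorem nonempty_algHom_of_finiteType (K C : Type*) [Field K] [IsAlgClosed K] [CommRing C]
    [Algebra K C] [Nontrivial C] [Algebra.FiniteType K C] : Nonempty (C →ₐ[K] K) := by
  obtain ⟨M, hM⟩ := Ideal.exists_maximal C
  let := Ideal.Quotient.field M
  have : Module.Finite K (C ⧸ M) := finite_of_finite_type_of_isJacobsonRing K (C ⧸ M)
  exact ⟨(IsAlgClosed.lift : (C ⧸ M) →ₐ[K] K).comp (Ideal.Quotient.mkₐ K M)⟩

/-- Specializations of the conjugates over `E` of the point `x`, chosen such that the independence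
of the values of `f` at `x` is preserved. -/
theorem exists_conjugate_specializations {K E F σ ι : Type*} [Field K] [IsAlgClosed K] [CharZero K]
    [Field E] [Field F] [Algebra K E] [Algebra E F] [Algebra K F] [IsScalarTower K E F]
    [FiniteDimensional E F] [Finite σ] [Fintype ι] (x : σ → F) (f : ι → MvPolynomial σ K)
    (hf : LinearIndependent E fun j => aeval x (f j)) :
    ∃ T : Set (σ → K),
      (∀ p ∈ T, ∀ g, aeval x g = 0 → eval p g = 0) ∧
      (∀ g, aeval x g ∈ Set.range (algebraMap E F) → ∀ p ∈ T, ∀ p' ∈ T, eval p g = eval p' g) ∧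
      ∀ c : ι → K, (∀ p ∈ T, ∑ j, c j * eval p (f j) = 0) → c = 0 := by
  classical
  have : CharZero E := charZero_of_injective_algebraMap (algebraMap K E).injective
  let Ω := AlgebraicClosure E
  let B := hf.linearIndepOn_id.extend (Set.subset_univ _)
  let b : Module.Basis B E F := Module.Basis.extend hf.linearIndepOn_id
  have hb : ∀ y : B, b y = y := Module.Basis.extend_apply_self hf.linearIndepOn_id
  let J : ι → B := fun j => ⟨aeval x (f j),
    hf.linearIndepOn_id.subset_extend (Set.subset_univ _) (Set.mem_range_self j)⟩
  have hJ : Function.Injective J := fun i j hij => hf.injective (congrArg Subtype.val hij)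
  have : Finite B := Module.Finite.finite_basis b
  have := Fintype.ofFinite B
  let ε : B ≃ (F →ₐ[E] Ω) := Fintype.equivOfCardEq
    ((Module.finrank_eq_card_basis b).symm.trans (AlgHom.card E F Ω).symm)
  let N : Matrix B B Ω := Matrix.of fun y i => ε i (b y)
  -- The square of this determinant is the discriminant of a basis of a separable extension.
  have hN : N.det ≠ 0 := by
    intro h0
    have h := Algebra.discr_eq_det_embeddingsMatrixReindex_pow_two E Ω b ε
    have h1 : Algebra.embeddingsMatrixReindex E Ω b ε = N := rfl
    rw [h1, h0, zero_pow two_ne_zero] at h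
    exact Algebra.discr_not_zero_of_basis E b (by simpa using h)
  -- Including `N.det⁻¹` keeps the determinant nonzero under any `K`-point of the algebra generated
  -- by `G`.
  let G : Set Ω := Set.range (fun p : B × σ => ε p.1 (x p.2)) ∪
    (Set.range (fun p : B × B => N p.1 p.2) ∪ {N.det⁻¹})
  have hG : G.Finite := (Set.finite_range _).union ((Set.finite_range _).union (Set.toFinite _))
  let C := Algebra.adjoin K G
  have hC : ∀ z ∈ G, z ∈ C := fun z hz => Algebra.subset_adjoin hz
  have : Algebra.FiniteType K C :=
    C.fg_iff_finiteType.1 (Subalgebra.fg_def.2 ⟨G, hG, rfl⟩)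
  obtain ⟨φ⟩ := nonempty_algHom_of_finiteType K C
  let X : B → σ → C := fun i s => ⟨ε i (x s), hC _ (.inl ⟨(i, s), rfl⟩)⟩
  have hX : ∀ i (g : MvPolynomial σ K), ((aeval (X i) g : C) : Ω) = ε i (aeval x g) := by
    intro i g
    change C.val (aeval (X i) g) = ((ε i).restrictScalars K) (aeval x g)
    rw [comp_aeval_apply, comp_aeval_apply]
    rfl
  have hφ : ∀ i (g : MvPolynomial σ K), eval (fun s => φ (X i s)) g = φ (aeval (X i) g) := by
    intro i g
    rw [comp_aeval_apply]
    rfl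
  refine ⟨Set.range fun i s => φ (X i s), ?_, ?_, fun c hc => ?_⟩
  · rintro _ ⟨i, rfl⟩ g hg
    have : aeval (X i) g = 0 := Subtype.ext (by rw [hX, hg, map_zero]; rfl)
    rw [hφ, this, map_zero]
  · rintro g ⟨a, ha⟩ _ ⟨i, rfl⟩ _ ⟨i', rfl⟩
    have : aeval (X i) g = aeval (X i') g := Subtype.ext (by
      rw [hX, hX, ← ha, AlgHom.commutes, AlgHom.commutes])
    rw [hφ, hφ, this]
  · let NC : Matrix B B C := Matrix.of fun y i => ⟨N y i, hC _ (.inr (.inl ⟨(y, i), rfl⟩))⟩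
    have hdet : C.val NC.det = N.det := by
      rw [AlgHom.map_det]
      rfl
    have h1 : NC.det * ⟨N.det⁻¹, hC _ (.inr (.inr rfl))⟩ = 1 := Subtype.ext (by
      change C.val NC.det * N.det⁻¹ = 1
      rw [hdet, mul_inv_cancel₀ hN])
    have hne : (φ.mapMatrix NC).det ≠ 0 := by
      rw [← AlgHom.map_det]
      intro h0
      have := congrArg φ h1
      rw [map_mul, h0, zero_mul, map_one] at this
      exact zero_ne_one this
    -- A relation on `T`, extended by zero to the whole basis, is a left null vector of the
    -- specialized matrix.
    have hz := Matrix.eq_zero_of_vecMul_eq_zero hne (v := Function.extend J c 0) (by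
      funext i
      rw [Pi.zero_apply, ← hc _ ⟨i, rfl⟩]
      refine (Fintype.sum_of_injective J hJ _ _ (fun y hy => ?_) fun j => ?_).symm
      · rw [Function.extend_apply' _ _ _ (by simpa using hy), Pi.zero_apply, zero_mul]
      · rw [hJ.extend_apply, hφ]
        refine congrArg (fun z : C => c j * φ z) (Subtype.ext ?_)
        rw [hX]
        change _ = ε i (b (J j))
        rw [hb])
    funext j
    rw [← hJ.extend_apply c 0 j, hz]
    rfl

end Specialization

/-! ### Cones, their ideals and dimension -/

section Cones

variable {K : Type*} [Field K] {n : ℕ}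

/-- The affine cone over a subset of `ℙⁿ`. -/
def cone (X : Set (ℙ K (Fin (n + 1) → K))) : Set (Fin (n + 1) → K) :=
  {v | ∀ hv : v ≠ 0, Projectivization.mk K v hv ∈ X}

theorem zero_mem_cone (X : Set (ℙ K (Fin (n + 1) → K))) : 0 ∈ cone X := fun h => absurd rfl h

theorem smul_mem_cone {X : Set (ℙ K (Fin (n + 1) → K))} {v : Fin (n + 1) → K} (hv : v ∈ cone X)
    (a : K) : a • v ∈ cone X := by
  intro h
  have hv0 : v ≠ 0 := right_ne_zero_of_smul h
  rw [(Projectivization.mk_eq_mk_iff' K (a • v) v h hv0).2 ⟨a, rfl⟩]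
  exact hv hv0

theorem rep_mem_cone {X : Set (ℙ K (Fin (n + 1) → K))} {p : ℙ K (Fin (n + 1) → K)} :
    p.rep ∈ cone X ↔ p ∈ X :=
  ⟨fun h => p.mk_rep ▸ h p.rep_nonzero, fun h _ => p.mk_rep.symm ▸ h⟩

theorem cone_subset_cone {X Y : Set (ℙ K (Fin (n + 1) → K))} : cone X ⊆ cone Y ↔ X ⊆ Y :=
  ⟨fun h _ hp => rep_mem_cone.1 (h (rep_mem_cone.2 hp)), fun h _ hv hv0 => h (hv hv0)⟩

theorem exists_eq_smul_rep {X : Set (ℙ K (Fin (n + 1) → K))} (hX : X.Nonempty)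
    {v : Fin (n + 1) → K} (hv : v ∈ cone X) : ∃ p ∈ X, ∃ a : K, v = a • p.rep := by
  by_cases h : v = 0
  · obtain ⟨p, hp⟩ := hX
    exact ⟨p, hp, 0, by simp [h]⟩
  · obtain ⟨a, ha⟩ := Projectivization.exists_smul_eq_mk_rep K v h
    refine ⟨_, hv h, (a⁻¹ : Kˣ), ?_⟩
    rw [← ha]
    simp [Units.smul_def, smul_smul]

theorem eval_smul_of_isHomogeneous {σ : Type*} {f : MvPolynomial σ K} {d : ℕ}
    (hf : f.IsHomogeneous d) (a : K) (v : σ → K) :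
    MvPolynomial.eval (a • v) f = a ^ d * MvPolynomial.eval v f := by
  rw [MvPolynomial.eval_eq, MvPolynomial.eval_eq, Finset.mul_sum]
  refine Finset.sum_congr rfl fun i hi => ?_
  have hdeg : ∑ j ∈ i.support, i j = d := by
    have := hf (MvPolynomial.mem_support_iff.1 hi)
    simpa [Finsupp.weight_apply, Finsupp.sum] using this
  simp only [Pi.smul_apply, smul_eq_mul, mul_pow, Finset.prod_mul_distrib]
  rw [Finset.prod_pow_eq_pow_sum, hdeg]
  ring

/-- The ideal of all polynomials vanishing on the cone over `X`. -/
noncomputable def coneIdeal (X : Set (ℙ K (Fin (n + 1) → K))) :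
    Ideal (MvPolynomial (Fin (n + 1)) K) :=
  MvPolynomial.vanishingIdeal K (cone X)

theorem mem_coneIdeal {X : Set (ℙ K (Fin (n + 1) → K))} {f : MvPolynomial (Fin (n + 1)) K} :
    f ∈ coneIdeal X ↔ ∀ v ∈ cone X, MvPolynomial.eval v f = 0 := by
  simp [coneIdeal, MvPolynomial.mem_vanishingIdeal_iff, MvPolynomial.aeval_eq_eval]

theorem homogeneousComponent_mem_coneIdeal [Infinite K] {X : Set (ℙ K (Fin (n + 1) → K))}
    {f : MvPolynomial (Fin (n + 1)) K} (hf : f ∈ coneIdeal X) (d : ℕ) :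
    MvPolynomial.homogeneousComponent d f ∈ coneIdeal X := by
  rw [mem_coneIdeal] at hf ⊢
  intro v hv
  -- This is `a ↦ f (a • v)`; it vanishes identically because the cone is stable under scaling.
  let q : Polynomial K := ∑ i ∈ Finset.range (f.totalDegree + 1),
    Polynomial.C (MvPolynomial.eval v (MvPolynomial.homogeneousComponent i f)) * Polynomial.X ^ i
  have hq : q = 0 := by
    refine Polynomial.funext fun a => ?_
    have h := hf (a • v) (smul_mem_cone hv a)
    rw [← MvPolynomial.sum_homogeneousComponent f, map_sum] at h
    rw [Polynomial.eval_zero, ← h, Polynomial.eval_finsetSum]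
    refine Finset.sum_congr rfl fun i _ => ?_
    rw [eval_smul_of_isHomogeneous (MvPolynomial.homogeneousComponent_isHomogeneous i f)]
    rw [Polynomial.eval_mul, Polynomial.eval_C, Polynomial.eval_pow, Polynomial.eval_X, mul_comm]
  by_cases hd : d < f.totalDegree + 1
  · have := congrArg (fun p => Polynomial.coeff p d) hq
    simp only [q, Polynomial.finsetSum_coeff, Polynomial.coeff_C_mul, Polynomial.coeff_X_pow,
      mul_ite, mul_one, mul_zero, Finset.sum_ite_eq, Finset.mem_range, hd, if_true,
      Polynomial.coeff_zero] at this
    exact this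
  · rw [MvPolynomial.homogeneousComponent_eq_zero _ _ (by omega), map_zero]

theorem isAlgebraicSet_of_isClosed {X : Set (ℙ K (Fin (n + 1) → K))}
    (hX : @IsClosed _ (zariskiTopology K n) X) : IsAlgebraicSet X := by
  let := zariskiTopology K n
  have h : IsAlgebraicSet Xᶜᶜ := hX.isOpen_compl
  rwa [compl_compl] at h

theorem mem_cone_iff {X : Set (ℙ K (Fin (n + 1) → K))} (hX : IsAlgebraicSet X)
    {v : Fin (n + 1) → K} : v ∈ cone X ↔ ∀ f ∈ coneIdeal X, MvPolynomial.eval v f = 0 := by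
  refine ⟨fun hv f hf => mem_coneIdeal.1 hf v hv, fun h hv => ?_⟩
  obtain ⟨S, hS, hXS⟩ := hX
  obtain ⟨i, hi⟩ := Function.ne_iff.1 hv
  rw [hXS]
  intro f hf
  obtain ⟨d, hd⟩ := hS f hf
  -- The factor `X i` forces vanishing at the origin, where a nonzero constant `f` (possible when
  -- `X` is empty) would fail.
  have hmem : f * MvPolynomial.X i ∈ coneIdeal X := by
    rw [mem_coneIdeal]
    intro w hw
    rw [map_mul, MvPolynomial.eval_X]
    by_cases hw0 : w = 0
    · simp [hw0]
    obtain ⟨a, ha⟩ := Projectivization.exists_smul_eq_mk_rep K w hw0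
    have h1 : MvPolynomial.eval (Projectivization.mk K w hw0).rep f = 0 := by
      have := hw hw0
      rw [hXS] at this
      exact this f hf
    rw [← ha, Units.smul_def, eval_smul_of_isHomogeneous hd] at h1
    rw [(mul_eq_zero.1 h1).resolve_left (pow_ne_zero _ a.ne_zero), zero_mul]
  have h2 := h _ hmem
  rw [map_mul, MvPolynomial.eval_X] at h2
  obtain ⟨a, ha⟩ := Projectivization.exists_smul_eq_mk_rep K v hv
  rw [← ha, Units.smul_def, eval_smul_of_isHomogeneous hd,
    (mul_eq_zero.1 h2).resolve_right hi, mul_zero]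

theorem coneIdeal_lt_coneIdeal {X Y : Set (ℙ K (Fin (n + 1) → K))} (hX : IsAlgebraicSet X)
    (h : X ⊂ Y) : coneIdeal Y < coneIdeal X := by
  refine lt_of_le_not_ge (MvPolynomial.vanishingIdeal_anti_mono (cone_subset_cone.2 h.1))
    fun hle => h.2 (cone_subset_cone.1 fun v hv => ?_)
  exact (mem_cone_iff hX).2 fun f hf => mem_coneIdeal.1 (hle hf) v hv

theorem cone_empty : cone (∅ : Set (ℙ K (Fin (n + 1) → K))) = {0} := by
  ext v
  simp [cone]

theorem isPrime_coneIdeal_empty : (coneIdeal (∅ : Set (ℙ K (Fin (n + 1) → K)))).IsPrime := by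
  rw [coneIdeal, cone_empty]
  infer_instance

theorem isClosed_zeroLocus_singleton {f : MvPolynomial (Fin (n + 1)) K} {d : ℕ}
    (hf : f.IsHomogeneous d) : @IsClosed _ (zariskiTopology K n) (zeroLocus {f}) := by
  let := zariskiTopology K n
  refine isOpen_compl_iff.1 (show IsAlgebraicSet (zeroLocus {f})ᶜᶜ from ?_)
  rw [compl_compl]
  refine ⟨{f}, ?_, rfl⟩
  rintro _ rfl
  exact ⟨d, hf⟩

-- The ideal is homogeneous, so primality may be tested on homogeneous elements, where it becomes
-- irreducibility of `X`.
attribute [local instance] MvPolynomial.gradedAlgebra in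
theorem isPrime_coneIdeal [Infinite K] {X : Set (ℙ K (Fin (n + 1) → K))}
    (hX : @IsIrreducible _ (zariskiTopology K n) X) : (coneIdeal X).IsPrime := by
  let := zariskiTopology K n
  have hmem : ∀ (f : MvPolynomial (Fin (n + 1)) K) (d : ℕ), f.IsHomogeneous d →
      (f ∈ coneIdeal X ↔ X ⊆ zeroLocus {f}) := by
    intro f d hd
    rw [mem_coneIdeal]
    constructor
    · rintro h p hp _ rfl
      exact h _ (rep_mem_cone.2 hp)
    · intro h v hv
      obtain ⟨p, hp, a, rfl⟩ := exists_eq_smul_rep hX.1 hv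
      rw [eval_smul_of_isHomogeneous hd, h hp f rfl, mul_zero]
  refine Ideal.IsHomogeneous.isPrime_of_homogeneous_mem_or_mem
    (𝒜 := MvPolynomial.homogeneousSubmodule (Fin (n + 1)) K) ?_ ?_ ?_
  · intro i f hf
    have := homogeneousComponent_mem_coneIdeal hf i
    rwa [← MvPolynomial.decomposition.decompose'_apply] at this
  · rw [Ideal.ne_top_iff_one, mem_coneIdeal]
    intro h
    simpa using h 0 (zero_mem_cone X)
  · rintro f g ⟨d, hf⟩ ⟨e, hg⟩ hfg
    have hf : f.IsHomogeneous d := hf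
    have hg : g.IsHomogeneous e := hg
    rw [hmem _ _ (hf.mul hg)] at hfg
    rw [hmem _ _ hf, hmem _ _ hg]
    refine isPreirreducible_iff_isClosed_union_isClosed.1 hX.2 _ _
      (isClosed_zeroLocus_singleton hf) (isClosed_zeroLocus_singleton hg) fun p hp => ?_
    have h := hfg hp _ rfl
    rw [map_mul, mul_eq_zero] at h
    rcases h with h | h
    · left
      rintro _ rfl
      exact h
    · right
      rintro _ rfl
      exact h

/-- A finite projection onto `ℙʳ` bounds the dimension by `r`. -/
theorem dimension_le_of_monic {X : Set (ℙ K (Fin (n + 1) → K))} [Infinite K]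
    (hX : IsIntegralSubvariety X) {r : ℕ}
    (ψ : MvPolynomial (Fin (r + 1)) K →+* MvPolynomial (Fin (n + 1)) K)
    (hψ : ∀ g, ∃ p : Polynomial (MvPolynomial (Fin (r + 1)) K), p.Monic ∧
      p.eval₂ ψ g ∈ coneIdeal X) : dimension X ≤ (r : WithBot ℕ∞) := by
  let := zariskiTopology K n
  have hcl : ∀ Z : TopologicalSpace.IrreducibleCloseds X, IsClosed (Subtype.val '' (Z : Set X)) :=
    fun Z => hX.1.isClosedEmbedding_subtypeVal.isClosedMap _ Z.isClosed'
  have hirr : ∀ Z : TopologicalSpace.IrreducibleCloseds X,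
      IsIrreducible (Subtype.val '' (Z : Set X)) :=
    fun Z => Z.isIrreducible'.image _ continuous_subtype_val.continuousOn
  -- The extra bottom element is the empty set, whose cone is the origin. It lengthens chains by
  -- one, matching the dimension `r + 1` of the polynomial ring.
  let A : WithBot (TopologicalSpace.IrreducibleCloseds X) → Set (ℙ K (Fin (n + 1) → K)) :=
    fun Z => Z.recBotCoe ∅ fun Z => Subtype.val '' (Z : Set X)
  have hAalg : ∀ Z, IsAlgebraicSet (A Z) := by
    intro Z
    induction Z with
    | bot => exact isAlgebraicSet_empty
    | coe Z => exact isAlgebraicSet_of_isClosed (hcl Z)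
  have hAprime : ∀ Z, (coneIdeal (A Z)).IsPrime := by
    intro Z
    induction Z with
    | bot => exact isPrime_coneIdeal_empty
    | coe Z => exact isPrime_coneIdeal (hirr Z)
  have hAsub : ∀ Z, A Z ⊆ X := by
    intro Z
    induction Z with
    | bot => exact Set.empty_subset _
    | coe Z => exact Subtype.coe_image_subset _ _
  have hAmono : ∀ Z Z', Z < Z' → A Z ⊂ A Z' := by
    intro Z Z' h
    induction Z' with
    | bot => exact absurd h not_lt_bot
    | coe Z' =>
      induction Z with
      | bot =>
        have : (A Z').Nonempty := (hirr Z').1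
        exact ⟨Set.empty_subset _, fun hs => Set.not_nonempty_empty (this.mono hs)⟩
      | coe Z =>
        exact Subtype.val_injective.image_strictMono
          (SetLike.coe_ssubset_coe.2 (WithBot.coe_lt_coe.1 h))
  let Φ : WithBot (TopologicalSpace.IrreducibleCloseds X) →
      (PrimeSpectrum (MvPolynomial (Fin (r + 1)) K))ᵒᵈ :=
    fun Z => OrderDual.toDual (PrimeSpectrum.comap ψ ⟨coneIdeal (A Z), hAprime Z⟩)
  -- Incomparability: distinct nested primes have distinct contractions along an integral extension.
  have hΦ : StrictMono Φ := by
    intro Z Z' h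
    have hlt := coneIdeal_lt_coneIdeal (hAalg Z) (hAmono Z Z' h)
    obtain ⟨hle, g, hg, hg'⟩ := SetLike.lt_iff_le_and_exists.1 hlt
    obtain ⟨p, hp, hpg⟩ := hψ g
    have := hAprime Z'
    have hpI : p.eval₂ ψ g ∈ coneIdeal (A Z') :=
      MvPolynomial.vanishingIdeal_anti_mono (cone_subset_cone.2 (hAsub Z')) hpg
    have : Nontrivial (MvPolynomial (Fin (r + 1)) K ⧸ (coneIdeal (A Z')).comap ψ) :=
      Ideal.Quotient.nontrivial_iff.2 (Ideal.IsPrime.ne_top inferInstance)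
    exact Ideal.comap_lt_comap_of_root_mem_sdiff hle ⟨hg, hg'⟩ (hp.map _).ne_zero hpI
  have : Nonempty (TopologicalSpace.IrreducibleCloseds X) := by
    obtain ⟨p, hp⟩ := hX.2.1
    exact ⟨⟨closure {⟨p, hp⟩}, isIrreducible_singleton.closure, isClosed_closure⟩⟩
  have h := Order.krullDim_le_of_strictMono Φ hΦ
  rw [Order.krullDim_withBot, Order.krullDim_orderDual] at h
  have hd : Order.krullDim (PrimeSpectrum (MvPolynomial (Fin (r + 1)) K)) = (r : WithBot ℕ∞) + 1 := by
    have := MvPolynomial.ringKrullDim_of_isNoetherianRing (R := K) (ι := Fin (r + 1))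
    rw [ringKrullDim_eq_zero_of_field, zero_add, Nat.card_fin] at this
    rw [← ringKrullDim, this]
    norm_cast
  rw [hd] at h
  change topologicalKrullDim X ≤ _
  exact ENat.WithBot.add_le_add_one_right_iff.1 h

end Cones

/-! ### Linear forms as polynomials -/

section LinearForms

variable {K : Type*} [Field K] {σ : Type*} [Fintype σ] [DecidableEq σ]

/-- The linear form attached to an element of the dual space. -/
noncomputable def linearForm : Module.Dual K (σ → K) →ₗ[K] MvPolynomial σ K where
  toFun ℓ := ∑ j, ℓ (Pi.single j 1) • MvPolynomial.X j
  map_add' ℓ ℓ' := by simp [add_smul, Finset.sum_add_distrib]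
  map_smul' a ℓ := by simp [mul_smul, Finset.smul_sum]

theorem linearForm_apply (ℓ : Module.Dual K (σ → K)) :
    linearForm ℓ = ∑ j, ℓ (Pi.single j 1) • MvPolynomial.X j := rfl

theorem eval_linearForm (ℓ : Module.Dual K (σ → K)) (v : σ → K) :
    MvPolynomial.eval v (linearForm ℓ) = ℓ v := by
  rw [linearForm_apply, LinearMap.pi_apply_eq_sum_univ ℓ v]
  simp only [map_sum, MvPolynomial.smul_eval, MvPolynomial.eval_X, smul_eq_mul]
  refine Finset.sum_congr rfl fun j _ => ?_
  rw [mul_comm]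
  congr 2
  ext i
  simp [Pi.single_apply, eq_comm]

theorem isHomogeneous_linearForm (ℓ : Module.Dual K (σ → K)) :
    (linearForm ℓ).IsHomogeneous 1 :=
  MvPolynomial.IsHomogeneous.sum _ _ _ fun j _ =>
    (MvPolynomial.homogeneousSubmodule σ K 1).smul_mem _ (MvPolynomial.isHomogeneous_X K j)

end LinearForms

/-! ### Generic points -/

section GenericPoint

open MvPolynomial

/-- A prime ideal of a polynomial ring has a generic point. -/
theorem exists_genericPoint {K : Type u} {σ : Type} [Field K] (I : Ideal (MvPolynomial σ K))
    [I.IsPrime] : ∃ (F : Type u) (_ : Field F) (_ : Algebra K F) (x : σ → F),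
      (∀ g, aeval x g = 0 ↔ g ∈ I) ∧ IntermediateField.adjoin K (Set.range x) = ⊤ := by
  let A := MvPolynomial σ K ⧸ I
  let F := FractionRing A
  let φ : MvPolynomial σ K →ₐ[K] F := (IsScalarTower.toAlgHom K A F).comp (Ideal.Quotient.mkₐ K I)
  have hφ : aeval (fun j => φ (X j)) = φ := (aeval_unique φ).symm
  refine ⟨F, inferInstance, inferInstance, fun j => φ (X j), fun g => ?_, ?_⟩
  · rw [hφ, ← Ideal.Quotient.eq_zero_iff_mem]
    exact map_eq_zero_iff _ (IsFractionRing.injective A F)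
  · rw [eq_top_iff]
    intro y _
    have key : ∀ a : A, algebraMap A F a ∈
        IntermediateField.adjoin K (Set.range fun j => φ (X j)) := by
      intro a
      obtain ⟨g, rfl⟩ := Ideal.Quotient.mk_surjective a
      refine IntermediateField.algebra_adjoin_le_adjoin K _ ?_
      rw [Algebra.adjoin_range_eq_range_aeval, hφ]
      exact ⟨g, rfl⟩
    obtain ⟨a, b, -, rfl⟩ := IsFractionRing.div_surjective (A := A) y
    exact div_mem (key a) (key b)

end GenericPoint

/-! ### Finiteness of a projection with center off `X` -/

section Projection

open MvPolynomial

attribute [local instance] MvPolynomial.gradedAlgebra in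
theorem homogeneousComponent_mul_of_isHomogeneous {σ R : Type*} [CommSemiring R]
    {f g : MvPolynomial σ R} {d : ℕ} (e : ℕ) (hg : g.IsHomogeneous d) :
    homogeneousComponent (e + d) (f * g) = homogeneousComponent e f * g := by
  have h := DirectSum.coe_decompose_mul_add_of_right_mem (homogeneousSubmodule σ R)
    (i := e) (a := f) hg
  have h' := decomposition.decompose'_apply (f * g) (e + d)
  have h'' := decomposition.decompose'_apply f e
  rw [← h', ← h'']
  exact h

variable {K F : Type*} [Field K] [Field F] [Algebra K F] {n r : ℕ}

/-- If linear forms have no common zero on `X` except the origin, then the projection they define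
is finite. -/
theorem exists_mulStable [IsAlgClosed K] {X : Set (ℙ K (Fin (n + 1) → K))}
    (hX : IsAlgebraicSet X) {x : Fin (n + 1) → F} (hx : ∀ g ∈ coneIdeal X, aeval x g = 0)
    {H : Fin (r + 1) → MvPolynomial (Fin (n + 1)) K} (hH : ∀ i, (H i).IsHomogeneous 1)
    (h0 : ∀ v ∈ cone X, (∀ i, eval v (H i) = 0) → v = 0) (hne : aeval x (H 0) ≠ 0) :
    ∃ b : Set F, b.Finite ∧ (∃ y ∈ b, y ≠ 0) ∧
      ∀ j, MulStable K (Set.range fun i => aeval x (H i)) b (x j) := by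
  have : Infinite K := IsAlgClosed.instInfinite
  set J := coneIdeal X ⊔ Ideal.span (Set.range H)
  -- Nullstellensatz: the only common zero of `J` is the origin, so a power `D` of the irrelevant
  -- ideal lies in `J`. The set `b` will span the values at `x` of the forms of degree `D`.
  have hJ : Ideal.span (Set.range
      (MvPolynomial.X : Fin (n + 1) → MvPolynomial (Fin (n + 1)) K)) ≤ J.radical := by
    rw [Ideal.span_le]
    rintro _ ⟨j, rfl⟩
    rw [SetLike.mem_coe, ← vanishingIdeal_zeroLocus_eq_radical (K := K), mem_vanishingIdeal_iff]
    intro v hv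
    rw [mem_zeroLocus_iff] at hv
    have : v = 0 := by
      refine h0 v ((mem_cone_iff hX).2 fun f hf => ?_) fun i => ?_
      · simpa [aeval_eq_eval] using hv f (Ideal.mem_sup_left hf)
      · simpa [aeval_eq_eval] using
          hv (H i) (Ideal.mem_sup_right (Ideal.subset_span (Set.mem_range_self i)))
    simp [this]
  obtain ⟨D, hD⟩ := Ideal.exists_pow_le_of_le_radical_of_fg hJ (IsNoetherian.noetherian _)
  obtain ⟨s, hs⟩ := (homogeneousSubmodule_fg (Fin (n + 1)) K D).map (aeval x).toLinearMap
  have hs' : ∀ g : MvPolynomial (Fin (n + 1)) K, g.IsHomogeneous D →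
      aeval x g ∈ Submodule.span K (s : Set F) := fun g hg => by
    rw [hs]
    exact Submodule.mem_map_of_mem (f := (aeval x).toLinearMap) hg
  refine ⟨s, s.finite_toSet, ?_, fun j y hy => ?_⟩
  · by_contra! hcon
    have hbot : Submodule.span K (s : Set F) = ⊥ := Submodule.span_eq_bot.2 hcon
    have h := hs' (H 0 ^ D) (by simpa using (hH 0).pow D)
    rw [hbot, Submodule.mem_bot, map_pow] at h
    exact hne (eq_zero_of_pow_eq_zero h)
  · have hy' := Submodule.subset_span (R := K) hy
    rw [hs] at hy'
    obtain ⟨g, hg, rfl⟩ := hy'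
    replace hg : g.IsHomogeneous D := hg
    have hXg : (g * MvPolynomial.X j).IsHomogeneous (D + 1) := hg.mul (isHomogeneous_X K j)
    have hmem : g * MvPolynomial.X j ∈ J := by
      refine hD (Ideal.mul_mem_right _ _ ?_)
      rw [Ideal.mem_span_pow_iff_exists_isHomogeneous]
      exact ⟨MvPolynomial.map C g, hg.map _, by
        rw [eval_map, eval₂_eta]⟩
    obtain ⟨i, hi, l, hl, hil⟩ := Submodule.mem_sup.1 hmem
    obtain ⟨a, rfl⟩ := Ideal.mem_span_range_iff_exists_fun.1 hl
    -- In degree `D + 1` the part from `coneIdeal X` dies at `x`, leaving products of the `H i` with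
    -- forms of degree `D`.
    have hcomp := congrArg (fun q => aeval x (homogeneousComponent (D + 1) q)) hil
    simp only [map_add, map_sum, homogeneousComponent_mul_of_isHomogeneous D (hH _),
      homogeneousComponent_eq_self hXg, hx _ (homogeneousComponent_mem_coneIdeal hi (D + 1)),
      zero_add, map_mul, aeval_X] at hcomp
    rw [AlgHom.toLinearMap_apply, mul_comm, ← hcomp, ← Submodule.span_mul_span]
    refine Submodule.sum_mem _ fun l _ => ?_
    rw [mul_comm (aeval x _)]
    exact Submodule.mul_mem_mul (Submodule.subset_span ⟨l, rfl⟩)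
      (hs' _ (homogeneousComponent_isHomogeneous _ _))

end Projection

/-! ### A maximal center disjoint from `X` -/

section ChoiceOfProjection

variable {K : Type*} [Field K] {n r : ℕ}

theorem dual_eq_zero_of_isNondegenerate {X : Set (ℙ K (Fin (n + 1) → K))}
    (hX : IsNondegenerate X) {ℓ : Module.Dual K (Fin (n + 1) → K)}
    (hℓ : ∀ v ∈ cone X, ℓ v = 0) : ℓ = 0 := by
  have hle : Projectivization.Subspace.span X ≤ (LinearMap.ker ℓ).projectivization := by
    rw [Projectivization.Subspace.span_le_subspace_iff]
    intro p hp
    induction p using Projectivization.ind with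
    | h v hv => exact (Submodule.mk_mem_projectivization_iff (LinearMap.ker ℓ) hv).2
                  (hℓ v fun _ => hp)
  rw [hX, top_le_iff] at hle
  refine LinearMap.ext fun v => ?_
  by_cases hv : v = 0
  · simp [hv]
  · have : Projectivization.mk K v hv ∈ (LinearMap.ker ℓ).projectivization := by
      rw [hle, ← Projectivization.Subspace.span_univ]
      exact Projectivization.Subspace.subset_span _ (Set.mem_univ _)
    exact (Submodule.mk_mem_projectivization_iff (LinearMap.ker ℓ) hv).1 this

/-- A linear subspace disjoint from `X` is contained in the center of a projection whose
restriction to `X` is finite and surjective. -/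
theorem exists_projection {X : Set (ℙ K (Fin (n + 1) → K))} (hX : X.Nonempty)
    {V : Submodule K (Fin (n + 1) → K)} (hV : ∀ v ∈ cone X, v ∈ V → v = 0) :
    ∃ (r : ℕ) (h : (Fin (n + 1) → K) →ₗ[K] (Fin (r + 1) → K)), V ≤ LinearMap.ker h ∧
      (∀ v ∈ cone X, h v = 0 → v = 0) ∧ ∀ a, ∃ v ∈ cone X, h v = a := by
  obtain ⟨U, ⟨hVU, hU⟩, hmax⟩ := (wellFounded_gt (α := Submodule K (Fin (n + 1) → K))).has_min
    {U | V ≤ U ∧ ∀ v ∈ cone X, v ∈ U → v = 0} ⟨V, le_rfl, hV⟩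
  obtain ⟨p, hp⟩ := hX
  have hpU : p.rep ∉ U := fun h => p.rep_nonzero (hU _ (rep_mem_cone.2 hp) h)
  have hq : Module.finrank K ((Fin (n + 1) → K) ⧸ U) ≠ 0 := by
    intro h0
    have := Module.finrank_zero_iff.1 h0
    exact hpU ((Submodule.Quotient.mk_eq_zero U).1 (Subsingleton.elim _ _))
  obtain ⟨r, hr⟩ := Nat.exists_eq_succ_of_ne_zero hq
  let e : ((Fin (n + 1) → K) ⧸ U) ≃ₗ[K] (Fin (r + 1) → K) :=
    LinearEquiv.ofFinrankEq _ _ (by rw [hr, Module.finrank_fin_fun])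
  let h : (Fin (n + 1) → K) →ₗ[K] (Fin (r + 1) → K) := e.toLinearMap ∘ₗ U.mkQ
  have hh : ∀ v, h v = 0 ↔ v ∈ U := fun v => by simp [h]
  refine ⟨r, h, fun v hv => (hh v).2 (hVU hv), fun v hv hv0 => hU v hv ((hh v).1 hv0), fun a => ?_⟩
  by_cases ha : a = 0
  · exact ⟨0, zero_mem_cone X, by rw [map_zero, ha]⟩
  obtain ⟨w, rfl⟩ : ∃ w, h w = a := by
    obtain ⟨y, rfl⟩ := e.surjective a
    obtain ⟨w, rfl⟩ := U.mkQ_surjective y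
    exact ⟨w, rfl⟩
  have hw : w ∉ U := fun hw => ha ((hh w).2 hw)
  have hlt : U < U ⊔ Submodule.span K {w} := by
    refine lt_of_le_of_ne le_sup_left fun heq => hw ?_
    rw [heq]
    exact Submodule.mem_sup_right (Submodule.mem_span_singleton_self w)
  -- By maximality the larger subspace meets the cone at some `z + c • w` with `z ∈ U`. Here `c ≠
  -- 0`, so rescaling gives a preimage of `h w`.
  obtain ⟨v, hv, hvU, hv0⟩ : ∃ v ∈ cone X, v ∈ U ⊔ Submodule.span K {w} ∧ v ≠ 0 := by
    by_contra! hcon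
    exact hmax _ ⟨hVU.trans le_sup_left, hcon⟩ hlt
  obtain ⟨z, hz, y, hy, rfl⟩ := Submodule.mem_sup.1 hvU
  obtain ⟨c, rfl⟩ := Submodule.mem_span_singleton.1 hy
  have hc : c ≠ 0 := by
    rintro rfl
    exact hv0 (hU _ hv (by simpa using hz))
  refine ⟨c⁻¹ • (z + c • w), smul_mem_cone hv _, ?_⟩
  rw [map_smul, map_add, (hh z).2 hz, map_smul, zero_add, smul_smul, inv_mul_cancel₀ hc, one_smul]

end ChoiceOfProjection

/-! ### The projection on the generic point -/

section FiniteProjection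

open MvPolynomial

/-- The components of a linear map to `K ^ τ`. -/
def component {K V τ : Type*} [Field K] [AddCommGroup V] [Module K V] (h : V →ₗ[K] (τ → K)) (i : τ) :
    Module.Dual K V :=
  LinearMap.proj i ∘ₗ h

theorem component_apply {K V τ : Type*} [Field K] [AddCommGroup V] [Module K V]
    (h : V →ₗ[K] (τ → K)) (i : τ) (v : V) : component h i v = h v i := rfl

variable {K : Type u} [Field K] [IsAlgClosed K] {n r : ℕ} {X : Set (ℙ K (Fin (n + 1) → K))}
  {h : (Fin (n + 1) → K) →ₗ[K] (Fin (r + 1) → K)}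

/-- A relation at the generic point holds on the whole cone; since `h` maps the cone onto `K ^ (r +
1)`, the polynomial vanishes everywhere. -/
theorem algebraicIndependent_projection {F : Type*} [Field F] [Algebra K F] {x : Fin (n + 1) → F}
    (hx : ∀ g, aeval x g = 0 → g ∈ coneIdeal X) (hsurj : ∀ a, ∃ v ∈ cone X, h v = a) :
    AlgebraicIndependent K fun i => aeval x (linearForm (component h i)) := by
  have : Infinite K := IsAlgClosed.instInfinite
  rw [algebraicIndependent_iff]
  intro P hP
  have hmem := hx (aeval (fun i => linearForm (component h i)) P) (by
    rw [← hP, ← AlgHom.comp_apply, comp_aeval])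
  refine MvPolynomial.funext fun a => ?_
  obtain ⟨v, hv, rfl⟩ := hsurj a
  have h1 := mem_coneIdeal.1 hmem v hv
  rw [← aeval_eq_eval, ← AlgHom.comp_apply, comp_aeval] at h1
  rw [map_zero, ← h1, ← aeval_eq_eval]
  congr 2
  funext i
  rw [aeval_eq_eval]
  exact (eval_linearForm (component h i) v).symm

theorem isIntegral_aeval_of_mulStable {K R F σ : Type*} [Field K] [CommRing R] [Field F] [Algebra K R]
    [Algebra R F] [Algebra K F] [IsScalarTower K R F] {m b : Set F} {x : σ → F}
    (hb : b.Finite) (hb0 : ∃ y ∈ b, y ≠ 0) (hmul : ∀ j, MulStable K m b (x j))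
    (hm : m ⊆ Set.range (algebraMap R F)) (g : MvPolynomial σ K) : IsIntegral R (aeval x g) := by
  induction g using MvPolynomial.induction_on with
  | C a =>
    rw [aeval_C, IsScalarTower.algebraMap_apply K R F]
    exact isIntegral_algebraMap
  | add f g hf hg => rw [map_add]; exact hf.add hg
  | mul_X f j hf =>
    rw [map_mul, aeval_X, ← div_one (x j)]
    exact hf.mul ((hmul j).isIntegral_div hb hb0 fun y hy => by rw [div_one]; exact hm hy)

theorem exists_monic_aeval_eval₂_eq_zero {K F σ τ : Type*} [Field K] [Field F] [Algebra K F]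
    {b : Set F} {x : σ → F} {H : τ → MvPolynomial σ K} (hb : b.Finite) (hb0 : ∃ y ∈ b, y ≠ 0)
    (hmul : ∀ j, MulStable K (Set.range fun i => aeval x (H i)) b (x j)) (g : MvPolynomial σ K) :
    ∃ p : Polynomial (MvPolynomial τ K), p.Monic ∧
      aeval x (p.eval₂ (aeval H : MvPolynomial τ K →ₐ[K] MvPolynomial σ K).toRingHom g) = 0 := by
  let φ : MvPolynomial τ K →ₐ[K] F := (aeval x).comp (aeval H)
  let := φ.toRingHom.toAlgebra
  have : IsScalarTower K (MvPolynomial τ K) F :=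
    IsScalarTower.of_algebraMap_eq fun a => (φ.commutes a).symm
  have hm : (Set.range fun i => aeval x (H i)) ⊆ Set.range (algebraMap (MvPolynomial τ K) F) := by
    rintro _ ⟨i, rfl⟩
    exact ⟨MvPolynomial.X i, congrArg (aeval x) (aeval_X H i)⟩
  obtain ⟨p, hp, hpg⟩ := isIntegral_aeval_of_mulStable hb hb0 hmul hm g
  refine ⟨p, hp, ?_⟩
  rw [← hpg]
  exact Polynomial.hom_eval₂ p (aeval H : _ →ₐ[K] MvPolynomial σ K).toRingHom
    (aeval x : _ →ₐ[K] F).toRingHom g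

theorem exists_mulStable_of_projection {F : Type*} [Field F] [Algebra K F] {x : Fin (n + 1) → F}
    (hX : IsAlgebraicSet X) (hx : ∀ g, aeval x g = 0 ↔ g ∈ coneIdeal X)
    (hinj : ∀ v ∈ cone X, h v = 0 → v = 0) (hsurj : ∀ a, ∃ v ∈ cone X, h v = a) :
    ∃ b : Set F, b.Finite ∧ (∃ y ∈ b, y ≠ 0) ∧
      ∀ j, MulStable K (Set.range fun i => aeval x (linearForm (component h i))) b (x j) :=
  exists_mulStable hX (H := fun i => linearForm (component h i)) (fun g => (hx g).2)
    (fun i => isHomogeneous_linearForm _)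
    (fun v hv hv0 => hinj v hv (funext fun i => by
      simpa only [eval_linearForm, component_apply, Pi.zero_apply] using hv0 i))
    ((algebraicIndependent_projection (fun g => (hx g).1) hsurj).ne_zero 0)

theorem dimension_le_of_projection (hX : IsIntegralSubvariety X)
    (hinj : ∀ v ∈ cone X, h v = 0 → v = 0) (hsurj : ∀ a, ∃ v ∈ cone X, h v = a) :
    dimension X ≤ (r : WithBot ℕ∞) := by
  have : Infinite K := IsAlgClosed.instInfinite
  have hXalg := isAlgebraicSet_of_isClosed hX.1
  have := isPrime_coneIdeal hX.2
  obtain ⟨F, _, _, x, hx, -⟩ := exists_genericPoint (coneIdeal X)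
  obtain ⟨b, hb, hb0, hmul⟩ := exists_mulStable_of_projection hXalg hx hinj hsurj
  exact dimension_le_of_monic hX
    (aeval fun i => linearForm (component h i) : _ →ₐ[K] MvPolynomial (Fin (n + 1)) K).toRingHom
    fun g => (exists_monic_aeval_eval₂_eq_zero hb hb0 hmul g).imp fun _ hp =>
      ⟨hp.1, (hx _).1 hp.2⟩

theorem isAlgebraic_mem_range {F : Type*} [Field F] [Algebra K F] {y : F} (hy : IsAlgebraic K y) :
    y ∈ Set.range (algebraMap K F) :=
  minpoly.mem_range_of_degree_eq_one K y
    (IsAlgClosed.degree_eq_one_of_irreducible K (minpoly.irreducible hy.isIntegral))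

theorem adjoin_lift_eq_top {K ι F : Type*} [Field K] [Field F] [Algebra K F] (y : ι → F) :
    IntermediateField.adjoin K (Set.range fun i =>
      (⟨y i, IntermediateField.subset_adjoin K _ ⟨i, rfl⟩⟩ :
        IntermediateField.adjoin K (Set.range y))) = ⊤ := by
  refine IntermediateField.map_injective (IntermediateField.adjoin K (Set.range y)).val ?_
  rw [IntermediateField.adjoin_map, ← Set.range_comp, ← AlgHom.fieldRange_eq_map,
    IntermediateField.fieldRange_val]
  rfl

end FiniteProjection

/-! ### The center lies in the span of a fibre -/

section SpanningTheCenter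

open MvPolynomial

variable {K : Type u} [Field K] {n r : ℕ} {X : Set (ℙ K (Fin (n + 1) → K))}
  {h : (Fin (n + 1) → K) →ₗ[K] (Fin (r + 1) → K)}

theorem linearIndependent_component (hsurj : ∀ a, ∃ v ∈ cone X, h v = a) :
    LinearIndependent K (component h) := by
  rw [Fintype.linearIndependent_iff]
  intro c hc i
  obtain ⟨v, -, hv⟩ := hsurj (Pi.single i 1)
  have := congrArg (fun ℓ : Module.Dual K (Fin (n + 1) → K) => ℓ v) hc
  simpa [LinearMap.sum_apply, component_apply, hv, Pi.single_apply] using this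

/-- A relation is an affine function vanishing on the cone. Its constant term is zero by evaluation
at the origin, and its linear part is zero by nondegeneracy. -/
theorem linearIndependent_one_linearForm {F κ : Type*} [Field F] [Algebra K F] [Fintype κ]
    {x : Fin (n + 1) → F} (hx : ∀ g, aeval x g = 0 → g ∈ coneIdeal X) (hnd : IsNondegenerate X)
    {D : κ → Module.Dual K (Fin (n + 1) → K)} (hD : LinearIndependent K D) :
    LinearIndependent K fun j : Option κ =>
      aeval x (j.elim 1 fun i => linearForm (D i) : MvPolynomial (Fin (n + 1)) K) := by
  rw [Fintype.linearIndependent_iff]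
  intro c hc
  let ℓ := ∑ i, c (some i) • D i
  have hmem : C (c none) + linearForm ℓ ∈ coneIdeal X := by
    refine hx _ ?_
    rw [← hc]
    simp [ℓ, Fintype.sum_option, Algebra.smul_def]
  have hval : ∀ v ∈ cone X, c none + ℓ v = 0 := fun v hv => by
    have := mem_coneIdeal.1 hmem v hv
    rwa [map_add, eval_C, eval_linearForm] at this
  have hnone : c none = 0 := by simpa using hval 0 (zero_mem_cone X)
  have hℓ : ℓ = 0 := dual_eq_zero_of_isNondegenerate hnd fun v hv => by
    simpa [hnone] using hval v hv
  have hsome := Fintype.linearIndependent_iff.1 hD (fun i => c (some i)) hℓ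
  rintro (_ | i)
  · exact hnone
  · exact hsome i

theorem mulStable_linearForm {F : Type*} [Field F] [Algebra K F] {x : Fin (n + 1) → F}
    {m b : Set F} (hmul : ∀ j, MulStable K m b (x j)) (ℓ : Module.Dual K (Fin (n + 1) → K)) :
    MulStable K m b (aeval x (linearForm ℓ)) := by
  simp only [linearForm_apply, map_sum, map_smul, aeval_X]
  exact MulStable.sum _ _ hmul

theorem finiteDimensional_adjoin_of_mulStable {F ι σ : Type*} [Field F] [Algebra K F] [Finite σ]
    {x : σ → F} (htop : IntermediateField.adjoin K (Set.range x) = ⊤) {y : ι → F} {b : Set F}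
    (hb : b.Finite) (hb0 : ∃ z ∈ b, z ≠ 0) (hmul : ∀ j, MulStable K (Set.range y) b (x j)) :
    FiniteDimensional (IntermediateField.adjoin K (Set.range y)) F := by
  have hint : ∀ z ∈ Set.range x, IsIntegral (IntermediateField.adjoin K (Set.range y)) z := by
    rintro _ ⟨j, rfl⟩
    rw [← aeval_X (R := K) x j]
    refine isIntegral_aeval_of_mulStable hb hb0 hmul ?_ _
    rintro _ ⟨i, rfl⟩
    exact ⟨⟨y i, IntermediateField.subset_adjoin K _ ⟨i, rfl⟩⟩, rfl⟩
  have h1 := IntermediateField.finiteDimensional_adjoin hint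
  rw [IntermediateField.adjoin_eq_top_of_adjoin_eq_top K htop] at h1
  exact LinearEquiv.finiteDimensional
    (IntermediateField.topEquiv (F := IntermediateField.adjoin K (Set.range y))).toLinearEquiv

theorem exists_linearIndependent_sumElim {K V ι : Type*} [Field K] [AddCommGroup V] [Module K V]
    [FiniteDimensional K V] {D : ι → V} (hD : LinearIndependent K D) :
    ∃ (d : ℕ) (g : Fin d → V), LinearIndependent K (Sum.elim D g) ∧
      Submodule.span K (Set.range D) ⊔ Submodule.span K (Set.range g) = ⊤ := by
  obtain ⟨Q, hQ⟩ := Submodule.exists_isCompl (Submodule.span K (Set.range D))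
  let B := Module.finBasis K Q
  have hgQ : Submodule.span K (Set.range (Q.subtype ∘ B)) = Q := by
    rw [Set.range_comp, Submodule.span_image, B.span_eq, Submodule.map_top, Submodule.range_subtype]
  exact ⟨_, Q.subtype ∘ B, hD.sum_type (B.linearIndependent.map' Q.subtype Q.ker_subtype)
    (hgQ.symm ▸ hQ.disjoint), hgQ.symm ▸ hQ.sup_eq_top⟩

/-- The conjugate specializations of a generic point span the center of the projection. -/
theorem exists_subset_cone_span [IsAlgClosed K] [CharZero K] (hX : IsIntegralSubvariety X)
    (hnd : IsNondegenerate X) (hinj : ∀ v ∈ cone X, h v = 0 → v = 0)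
    (hsurj : ∀ a, ∃ v ∈ cone X, h v = a) :
    ∃ T ⊆ cone X, LinearMap.ker h ≤ Submodule.span K T ∧
      Module.finrank K (Submodule.span K T) + r ≤ n + 1 := by
  have : Infinite K := IsAlgClosed.instInfinite
  have hXalg := isAlgebraicSet_of_isClosed hX.1
  have := isPrime_coneIdeal hX.2
  obtain ⟨F, _, _, x, hx, htop⟩ := exists_genericPoint (coneIdeal X)
  obtain ⟨b, hb, hb0, hmul⟩ := exists_mulStable_of_projection hXalg hx hinj hsurj
  have hind := algebraicIndependent_projection (fun g => (hx g).1) hsurj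
  set y : Fin (r + 1) → F := fun i => aeval x (linearForm (component h i)) with hy
  let E := IntermediateField.adjoin K (Set.range y)
  let u : Fin (r + 1) → E := fun i => ⟨y i, IntermediateField.subset_adjoin K _ ⟨i, rfl⟩⟩
  have hfin : FiniteDimensional E F := finiteDimensional_adjoin_of_mulStable htop hb hb0 hmul
  have hu : AlgebraicIndependent K u := AlgebraicIndependent.of_comp E.val hind
  obtain ⟨d, g, hD, hsup⟩ := exists_linearIndependent_sumElim (K := K)
    (V := Module.Dual K (Fin (n + 1) → K)) (D := component h) (linearIndependent_component hsurj)
  -- The constant `1` is included to absorb the constant value of `h` on `T`.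
  let f : Option (Fin d) → MvPolynomial (Fin (n + 1)) K :=
    fun j => j.elim 1 fun i => linearForm (g i)
  have hm : Set.range y ⊆ Submodule.span K (insert 1 (Set.range y)) :=
    (Set.subset_insert _ _).trans Submodule.subset_span
  have hw : ∀ j, MulStable K (insert 1 (Set.range y)) b (aeval x (f j)) := by
    rintro (_ | j)
    · intro z hz
      rw [show aeval x (f none) = 1 from map_one _, one_mul]
      exact Submodule.subset_span ⟨1, Set.mem_insert _ _, z, hz, one_mul z⟩
    · exact (mulStable_linearForm hmul (g j)).of_subset_span hm
  have hindK : LinearIndependent K (Sum.elim y fun j => aeval x (f j)) := by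
    let e : Fin (r + 1) ⊕ Option (Fin d) → Option (Fin (r + 1) ⊕ Fin d) :=
      Sum.elim (fun i => some (Sum.inl i)) (Option.map Sum.inr)
    have he : Function.Injective e := by
      rintro (i | _ | i) (j | _ | j) hij <;> simp_all [e]
    have := (linearIndependent_one_linearForm (fun g => (hx g).1) hnd hD).comp e he
    convert this using 1
    ext (i | _ | i) <;> rfl
  have hindE : LinearIndependent E fun j => aeval x (f j) :=
    linearIndependent_of_mulStable hb hb0 (j₀ := none) (map_one _) r
      (fun z hz => isAlgebraic_mem_range hz) hu (adjoin_lift_eq_top y) hw hindK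
  obtain ⟨T, hTX, hTconst, hTind⟩ := exists_conjugate_specializations x f hindE
  have hTcone : T ⊆ cone X := fun p hp =>
    (mem_cone_iff hXalg).2 fun g hg => hTX p hp g ((hx g).2 hg)
  have hTh : ∀ p ∈ T, ∀ p' ∈ T, h p = h p' := fun p hp p' hp' => funext fun i => by
    have := hTconst (linearForm (component h i)) ⟨u i, rfl⟩ p hp p' hp'
    rwa [eval_linearForm, eval_linearForm] at this
  -- On an empty `T` every coefficient vector would be a relation.
  obtain ⟨p₀, hp₀⟩ : T.Nonempty := by
    by_contra hT
    rw [Set.not_nonempty_iff_eq_empty] at hT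
    exact one_ne_zero (congrFun (hTind 1 (by simp [hT])) none)
  refine ⟨T, hTcone, fun v hv => ?_, ?_⟩
  -- Take a functional vanishing on `T` but not at `v`. Its `component h` part is constant on `T`,
  -- so the independence on `T` kills the complementary part; what remains vanishes on `ker h`,
  -- which contains `v`.
  · by_contra hvT
    obtain ⟨ℓ, hℓv, hℓ⟩ := Submodule.exists_le_ker_of_notMem hvT
    obtain ⟨ℓ₁, h₁, ℓ₂, h₂, rfl⟩ := Submodule.mem_sup.1 (hsup.symm ▸ Submodule.mem_top (x := ℓ))
    obtain ⟨a, rfl⟩ := (Submodule.mem_span_range_iff_exists_fun K).1 h₁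
    obtain ⟨c, rfl⟩ := (Submodule.mem_span_range_iff_exists_fun K).1 h₂
    have hc := hTind (fun j => j.elim (∑ i, a i * h p₀ i) c) fun p hp => by
      have : (∑ i, a i • component h i + ∑ j, c j • g j) p = 0 := hℓ (Submodule.subset_span hp)
      rw [Fintype.sum_option]
      simpa [f, LinearMap.sum_apply, component_apply, hTh p hp p₀ hp₀, eval_linearForm] using this
    have hc' : ∀ j, c j = 0 := fun j => congrFun hc (some j)
    refine hℓv ?_
    rw [LinearMap.mem_ker] at hv
    simp [LinearMap.sum_apply, component_apply, hc', hv]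
  -- `T` lies in one fibre `p₀ + ker h`, and `ker h` has dimension `n - r`.
  · have hle : Submodule.span K T ≤ LinearMap.ker h ⊔ Submodule.span K {p₀} := by
      refine Submodule.span_le.2 fun p hp => ?_
      rw [← sub_add_cancel p p₀]
      refine Submodule.add_mem_sup ?_ (Submodule.mem_span_singleton_self p₀)
      rw [LinearMap.mem_ker, map_sub, hTh p hp p₀ hp₀, sub_self]
    have hrange : LinearMap.range h = ⊤ :=
      LinearMap.range_eq_top.2 fun a => (hsurj a).imp fun _ hv => hv.2
    have h1 := LinearMap.finrank_range_add_finrank_ker h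
    rw [hrange, finrank_top, Module.finrank_fin_fun, Module.finrank_fin_fun] at h1
    have h2 := Submodule.finrank_mono hle
    have h3 := Submodule.finrank_add_le_finrank_add_finrank (LinearMap.ker h)
      (Submodule.span K {p₀})
    have h4 : Module.finrank K (Submodule.span K {p₀}) ≤ 1 := by
      simpa using finrank_span_le_card (R := K) ({p₀} : Set (Fin (n + 1) → K))
    omega

end SpanningTheCenter

/-! ### From spanning vectors to the rank -/

section Rank

variable {K : Type*} [Field K] {n : ℕ}

/-- The rank is bounded by the dimension of the span of vectors in the cone. -/
theorem rank_le_of_le_span {X : Set (ℙ K (Fin (n + 1) → K))}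
    {V : Projectivization.Subspace K (Fin (n + 1) → K)} {T : Set (Fin (n + 1) → K)}
    (hT : T ⊆ cone X) (hV : Projectivization.Subspace.submodule V ≤ Submodule.span K T) :
    rank X V ≤ Module.finrank K (Submodule.span K T) := by
  classical
  obtain ⟨f, hfT, hspan, hf⟩ := Submodule.exists_fun_fin_finrank_span_eq K T
  let S := Finset.univ.image fun i => Projectivization.mk K (f i) (hf.ne_zero i)
  have hS : Submodule.span K T ≤
      Projectivization.Subspace.submodule (Projectivization.Subspace.span (S : Set _)) := by
    rw [← hspan, Submodule.span_le]
    rintro _ ⟨i, rfl⟩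
    refine (Projectivization.Subspace.mem_submodule_iff _ (hf.ne_zero i)).2
      (Projectivization.Subspace.subset_span _ ?_)
    simp [S]
  have hSX : (S : Set (ℙ K (Fin (n + 1) → K))) ⊆ X := by
    intro p hp
    obtain ⟨i, -, rfl⟩ := Finset.mem_image.1 hp
    exact hT (hfT i) _
  refine (iInf_le_of_le S (iInf_le_of_le hSX (iInf_le _ ?_))).trans ?_
  · exact Projectivization.Subspace.submodule.le_iff_le.1 (hV.trans hS)
  · exact_mod_cast Finset.card_image_le.trans (by simp)

theorem span_cone_le_submodule (X : Set (ℙ K (Fin (n + 1) → K))) :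
    Submodule.span K (cone X) ≤
      Projectivization.Subspace.submodule (Projectivization.Subspace.span X) := by
  refine Submodule.span_le.2 fun v hv => ?_
  by_cases hv0 : v = 0
  · rw [hv0]
    exact Submodule.zero_mem _
  · exact (Projectivization.Subspace.mem_submodule_iff _ hv0).2
      (Projectivization.Subspace.subset_span _ (hv hv0))

end Rank

end XRank

/-! ### The bound on the rank -/

theorem proposition3 {K : Type*} [Field K] [IsAlgClosed K] [CharZero K] (n m : ℕ)
    (X : Set (ℙ K (Fin (n + 1) → K))) (hX : XRank.IsIntegralSubvariety X)
    (hnd : XRank.IsNondegenerate X) (hm : XRank.dimension X = (m : WithBot ℕ∞))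
    (V : Projectivization.Subspace K (Fin (n + 1) → K)) :
    ∃ r : ℕ, XRank.rank X V = (r : ℕ∞) ∧
      (r : ℤ) ≤ (n : ℤ) + 2 - (m : ℤ) +
        XRank.linearDim (Projectivization.Subspace.span
          (X ∩ (V : Set (ℙ K (Fin (n + 1) → K))))) := by
  set Z : Set (ℙ K (Fin (n + 1) → K)) := X ∩ (V : Set (ℙ K (Fin (n + 1) → K))) with hZ
  have hZV : Submodule.span K (XRank.cone Z) ≤ Projectivization.Subspace.submodule V :=
    (XRank.span_cone_le_submodule Z).trans (Projectivization.Subspace.submodule.monotone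
      (Projectivization.Subspace.span_le_subspace_iff.2 Set.inter_subset_right))
  obtain ⟨U, hdisj, hsup⟩ := IsModularLattice.exists_disjoint_and_sup_eq hZV
  -- A point of `X` in `U ⊆ V` belongs to `Z`, whose span is disjoint from `U`.
  have hU : ∀ v ∈ XRank.cone X, v ∈ U → v = 0 := by
    intro v hv hvU
    by_contra hv0
    have hvV : v ∈ Projectivization.Subspace.submodule V :=
      (le_sup_right.trans hsup.le : U ≤ _) hvU
    have hvZ : v ∈ XRank.cone Z := fun _ =>
      ⟨hv hv0, (Projectivization.Subspace.mem_submodule_iff V hv0).1 hvV⟩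
    exact hv0 (Submodule.disjoint_def.1 hdisj v (Submodule.subset_span hvZ) hvU)
  obtain ⟨r, h, hUh, hinj, hsurj⟩ := XRank.exists_projection hX.2.1 hU
  have hmr : m ≤ r := by
    have := XRank.dimension_le_of_projection hX hinj hsurj
    rw [hm] at this
    exact_mod_cast this
  obtain ⟨T, hTX, hTh, hTr⟩ := XRank.exists_subset_cone_span hX hnd hinj hsurj
  have hcone : XRank.cone Z ∪ T ⊆ XRank.cone X :=
    Set.union_subset (XRank.cone_subset_cone.2 Set.inter_subset_left) hTX
  have hrank := XRank.rank_le_of_le_span hcone (V := V) (by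
    rw [← hsup, Submodule.span_union]
    exact sup_le_sup_left (hUh.trans hTh) _)
  obtain ⟨k, hk⟩ := ENat.ne_top_iff_exists.1 (ne_top_of_le_ne_top (ENat.natCast_ne_top _) hrank)
  refine ⟨k, hk.symm, ?_⟩
  rw [← hk, Nat.cast_le, Submodule.span_union] at hrank
  have h1 := Submodule.finrank_add_le_finrank_add_finrank (Submodule.span K (XRank.cone Z))
    (Submodule.span K T)
  have h2 := Submodule.finrank_mono (XRank.span_cone_le_submodule Z)
  -- The `- 1` in `linearDim` turns the bound `n + 1 - r` for `T` into the stated `n + 2 - m`.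
  rw [XRank.linearDim]
  omega
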